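/- A $d$-cube is a polytope (the convex hull of finitely many points of some $\mathbb{R}^n$) whose face lattice is isomorphic to the face lattice of $[0,1]^d$. The graph of a polytope consists of its vertices and edges. A $d$-polytope is *strongly $\lfloor (d+1)/2\rfloor$-linked* if its graph has at least $d+1$ vertices and, for every set $X$ of exactly $d+1$ vertices and every collection of $k=\lfloor (d+1)/2\rfloor$ pairwise disjoint pairs $\{s_1,t_1\},\dots,\{s_k,t_k\}$ of distinct vertices of $X$, there are pairwise vertex-disjoint paths $L_1,\dots,L_k$ in the graph such that $L_i$ joins $s_i$ to $t_i$ and no $L_i$ contains a vertex of $X$ outside $\{s_1,t_1,\dots,s_k,t_k\}$. **Theorem (strong linkedness of the cube).** For every integer $d\ge 0$ with $d\ne 3$, every $d$-cube is strongly $\lfloor (d+1)/2\rfloor$-linked. -/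

import Mathlib

/-- A (convex) polytope in `ℝⁿ`: the convex hull of a finite set of points. -/
def IsPolytope {n : ℕ} (P : Set (EuclideanSpace ℝ (Fin n))) : Prop :=
  ∃ S : Set (EuclideanSpace ℝ (Fin n)), S.Finite ∧ P = convexHull ℝ S

/-- The face lattice of `P`, ordered by inclusion. A face is the empty set or the set of points
of `P` at which some linear functional attains its maximum over `P`; so `∅` and `P` itself are
faces. -/
abbrev FaceLattice {n : ℕ} (P : Set (EuclideanSpace ℝ (Fin n))) : Type :=
  {F : Set (EuclideanSpace ℝ (Fin n)) // IsExposed ℝ P F}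

/-- The standard cube `[0,1]^d` in `ℝ^d`. -/
def stdCube (d : ℕ) : Set (EuclideanSpace ℝ (Fin d)) :=
  {x | ∀ i, 0 ≤ x i ∧ x i ≤ 1}

/-- A `d`-cube: a polytope, in a space of any dimension, that is combinatorially equivalent to
`[0,1]^d`, i.e. the two face lattices are isomorphic. -/
def IsCube {n : ℕ} (d : ℕ) (P : Set (EuclideanSpace ℝ (Fin n))) : Prop :=
  IsPolytope P ∧ Nonempty (FaceLattice P ≃o FaceLattice (stdCube d))

/-- The graph of a polytope: its vertices are the points `v` such that `{v}` is a face, and two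
distinct vertices are adjacent when the segment joining them is a face. -/
def polytopeGraph {n : ℕ} (P : Set (EuclideanSpace ℝ (Fin n))) :
    SimpleGraph {v : EuclideanSpace ℝ (Fin n) // IsExposed ℝ P {v}} where
  Adj u v := u ≠ v ∧ IsExposed ℝ P (segment ℝ u.1 v.1)
  symm := ⟨fun u v h => ⟨h.1.symm, by rw [segment_symm]; exact h.2⟩⟩
  loopless := ⟨fun _ h => h.1 rfl⟩

/-- A graph is strongly `⌊(d+1)/2⌋`-linked (with respect to `d`) if it has at least `d + 1`
vertices and, for every set `X` of exactly `d + 1` vertices and every choice of `⌊(d+1)/2⌋`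
pairwise disjoint pairs `{s i, t i}` of distinct vertices of `X`, there are pairwise
vertex-disjoint paths `L i` from `s i` to `t i`, each avoiding the vertices of `X` that are in
none of the pairs. -/
def IsStronglyLinked {V : Type*} (d : ℕ) (G : SimpleGraph V) : Prop :=
  ((d + 1 : ℕ) : ℕ∞) ≤ ENat.card V ∧
  ∀ X : Finset V, X.card = d + 1 →
    ∀ s t : Fin ((d + 1) / 2) → V,
      (∀ i, s i ∈ X) → (∀ i, t i ∈ X) → Function.Injective (Sum.elim s t) →
      ∃ L : ∀ i, G.Path (s i) (t i),
        (∀ i j, i ≠ j → ∀ v, v ∈ (L i).1.support → v ∉ (L j).1.support) ∧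
        ∀ x ∈ X, (∀ j, x ≠ s j ∧ x ≠ t j) → ∀ i, x ∉ (L i).1.support

/-! ### Coloured linkages -/

/-! A linkage is encoded as a colouring. Terminals carry labels, each used at most twice, and the
labelling must extend to all vertices so that equally labelled terminals are joined by monochromatic
walks. Distinct colours make the paths disjoint, and a label used once protects its vertex from the
other paths. `CubeLinked d` asserts this for up to `d + 1` terminals and is proved by induction from
`d = 4`. Dimension 3 fails, because the two diagonals of a square face cannot be linked in a planar
graph; so dimension 4 rests on a finite computation (`exists_connSets`), and dimensions 0, 1, 2 are
direct.

For the step from `d` to `d + 1`, a direction `i` cuts the cube into two facets. Each pair separated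
by the cut crosses along one edge in direction `i`, whose ends become extra terminals. A facet may
then hold `d + 2` terminals, one more than the induction hypothesis allows. One is saved on each
side by a pair that does not cross, or by a terminal that crosses at once along its own edge
(`CubeLinked.linkable_of_released`). If all terminals lie in one facet, the opposite facet is free
for detours (`CubeLinked.linkable_of_facet`).

If every direction fails, the terminals form an `IsObstruction`. Counting arguments then show that
the flip of a crossing vertex stays in `X`. This forces `X` to be a vertex with all its neighbours,
and then some pair spans an edge, which is excluded.

An isomorphism of face lattices matches atoms, hence vertices, and sends an edge of the standard
cube to a face with exactly two vertices, a segment. So the polytope graph contains the cube graph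
as a spanning subgraph, which is all that is needed. -/

/-- The subgraph of `G` inside `A` whose edges join vertices of equal colour. -/
def monoOn {V : Type*} (G : SimpleGraph V) (c : V → ℕ) (A : Set V) : SimpleGraph V where
  Adj u v := G.Adj u v ∧ c u = c v ∧ u ∈ A ∧ v ∈ A
  symm := ⟨fun _ _ h => ⟨h.1.symm, h.2.1.symm, h.2.2.2, h.2.2.1⟩⟩
  loopless := ⟨fun _ h => h.1.ne rfl⟩

theorem monoOn_le {V : Type*} {G : SimpleGraph V} {c c' : V → ℕ} {A B : Set V} (hAB : A ⊆ B)
    (hc : ∀ u ∈ A, c u = c' u) : monoOn G c A ≤ monoOn G c' B := by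
  intro u v h
  exact ⟨h.1, by rw [← hc u h.2.2.1, ← hc v h.2.2.2, h.2.1], hAB h.2.2.1, hAB h.2.2.2⟩

theorem color_eq_of_reachable {V : Type*} {G : SimpleGraph V} {c : V → ℕ} {A : Set V} {u v : V}
    (h : (monoOn G c A).Reachable u v) : c u = c v := by
  obtain ⟨w⟩ := h
  induction w with
  | nil => rfl
  | cons h _ ih => exact h.2.1.trans ih

/-- Every label is used at most twice on `Y`. -/
def PairLabelled {V : Type*} (Y : Finset V) (l : V → ℕ) : Prop :=
  ∀ x ∈ Y, ∀ y ∈ Y, ∀ z ∈ Y, l x = l y → l x = l z → x = y ∨ x = z ∨ y = z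

/-- The labelling of `Y` extends to a colouring in which points of `Y` with the same label are
joined inside `A` by monochromatic walks. -/
def Linkable {V : Type*} (G : SimpleGraph V) (A : Set V) (Y : Finset V) (l : V → ℕ) : Prop :=
  ∃ c : V → ℕ, (∀ y ∈ Y, c y = l y) ∧
    ∀ x ∈ Y, ∀ y ∈ Y, l x = l y → (monoOn G c A).Reachable x y

/-- `σ` exchanges the two points of each label class of `X` of size two and fixes the others. -/
structure IsPartner {V : Type*} (X : Finset V) (l : V → ℕ) (σ : V → V) : Prop where
  mem : ∀ x ∈ X, σ x ∈ X
  label : ∀ x ∈ X, l (σ x) = l x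
  invol : ∀ x ∈ X, σ (σ x) = x
  eq_or : ∀ x ∈ X, ∀ y ∈ X, l x = l y → y = x ∨ y = σ x

theorem PairLabelled.exists_isPartner {V : Type*} {X : Finset V} {l : V → ℕ}
    (h : PairLabelled X l) : ∃ σ, IsPartner X l σ := by
  classical
  have key : ∀ x, ∃ y, x ∈ X → (y ∈ X ∧ l y = l x ∧ ∀ z ∈ X, l x = l z → z = x ∨ z = y) := by
    intro x
    by_cases hx : x ∈ X
    · by_cases hy : ∃ y ∈ X, y ≠ x ∧ l y = l x
      · obtain ⟨y, hy, hne, hl⟩ := hy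
        refine ⟨y, fun _ => ⟨hy, hl, fun z hz hlz => ?_⟩⟩
        rcases h x hx y hy z hz hl.symm hlz with h | h | h
        · exact absurd h.symm hne
        · exact Or.inl h.symm
        · exact Or.inr h.symm
      · push Not at hy
        refine ⟨x, fun _ => ⟨hx, rfl, fun z hz hlz => ?_⟩⟩
        by_contra hzx
        exact hy z hz (fun h => hzx (Or.inl h)) hlz.symm
    · exact ⟨x, fun h => absurd h hx⟩
  choose σ hσ using key
  refine ⟨σ, fun x hx => (hσ x hx).1, fun x hx => (hσ x hx).2.1, fun x hx => ?_,
    fun x hx => (hσ x hx).2.2⟩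
  have h1 := hσ x hx
  have h2 := hσ (σ x) h1.1
  rcases h1.2.2 (σ (σ x)) h2.1 (by rw [h2.2.1, h1.2.1]) with h | h
  · exact h
  · rcases h2.2.2 x hx h1.2.1 with h' | h'
    · exact h.trans h'.symm
    · exact h'.symm

/-! ### The graph of the cube -/

/-- Change the `i`-th coordinate. -/
def flipAt {d : ℕ} (x : Fin d → Bool) (i : Fin d) : Fin d → Bool :=
  Function.update x i (!x i)

@[simp] theorem flipAt_same {d : ℕ} (x : Fin d → Bool) (i : Fin d) : flipAt x i i = !x i := by
  simp [flipAt]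

theorem flipAt_of_ne {d : ℕ} (x : Fin d → Bool) {i j : Fin d} (h : j ≠ i) :
    flipAt x i j = x j := by
  simp [flipAt, h]

@[simp] theorem flipAt_flipAt {d : ℕ} (x : Fin d → Bool) (i : Fin d) :
    flipAt (flipAt x i) i = x := by
  simp [flipAt]

theorem flipAt_ne {d : ℕ} (x : Fin d → Bool) (i : Fin d) : flipAt x i ≠ x := by
  intro h
  have := congrFun h i
  simp at this

theorem flipAt_comm {d : ℕ} (x : Fin d → Bool) (i j : Fin d) :
    flipAt (flipAt x i) j = flipAt (flipAt x j) i := by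
  by_cases h : i = j
  · subst h; rfl
  · ext k
    by_cases hi : k = i <;> by_cases hj : k = j <;> simp_all [flipAt]

theorem flipAt_injective {d : ℕ} (i : Fin d) :
    Function.Injective (fun x : Fin d → Bool => flipAt x i) := by
  intro x y h
  simpa using congrArg (fun z => flipAt z i) h

/-- The graph of the `d`-dimensional cube. -/
def cubeGraph (d : ℕ) : SimpleGraph (Fin d → Bool) where
  Adj x y := ∃ i, y = flipAt x i
  symm := ⟨fun x y ⟨i, h⟩ => ⟨i, by simp [h]⟩⟩
  loopless := ⟨fun x ⟨i, h⟩ => flipAt_ne x i h.symm⟩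

theorem cubeGraph_adj_flipAt {d : ℕ} (x : Fin d → Bool) (i : Fin d) :
    (cubeGraph d).Adj x (flipAt x i) := ⟨i, rfl⟩

/-- Every labelling of at most `d + 1` vertices with each label used at most twice is linkable. -/
def CubeLinked (d : ℕ) : Prop :=
  ∀ (Y : Finset (Fin d → Bool)) (l : (Fin d → Bool) → ℕ), Y.card ≤ d + 1 → PairLabelled Y l →
    Linkable (cubeGraph d) Set.univ Y l

theorem flipAt_insertNth {d : ℕ} (i : Fin (d + 1)) (b : Bool) (y : Fin d → Bool) :
    flipAt (i.insertNth b y : Fin (d + 1) → Bool) i = i.insertNth (!b) y := by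
  ext k
  refine Fin.succAboveCases i ?_ (fun j => ?_) k
  · simp
  · rw [flipAt_of_ne _ (Fin.succAbove_ne i j)]; simp

theorem flipAt_insertNth_succAbove {d : ℕ} (i : Fin (d + 1)) (b : Bool) (y : Fin d → Bool)
    (j : Fin d) : flipAt (i.insertNth b y : Fin (d + 1) → Bool) (i.succAbove j)
      = i.insertNth b (flipAt y j) := by
  ext k
  refine Fin.succAboveCases i ?_ (fun m => ?_) k
  · rw [flipAt_of_ne _ (Fin.succAbove_ne i j).symm]; simp
  · by_cases h : m = j
    · subst h; simp
    · rw [flipAt_of_ne _ (fun e => h (Fin.succAbove_right_injective e))]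
      simp [flipAt_of_ne _ h]

/-- A facet of the cube inherits linkages from the cube of one dimension less. -/
theorem CubeLinked.facet {d : ℕ} (hd : CubeLinked d) (i : Fin (d + 1)) (b : Bool)
    (Y : Finset (Fin (d + 1) → Bool)) (l : (Fin (d + 1) → Bool) → ℕ) (hY : ∀ y ∈ Y, y i = b)
    (hc : Y.card ≤ d + 1) (hl : PairLabelled Y l) :
    Linkable (cubeGraph (d + 1)) {x | x i = b} Y l := by
  classical
  set e : (Fin d → Bool) → (Fin (d + 1) → Bool) := fun y => i.insertNth b y with he
  set r : (Fin (d + 1) → Bool) → (Fin d → Bool) := fun x => i.removeNth x with hr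
  have her : ∀ y ∈ Y, e (r y) = y := by
    intro y hy
    simp only [he, hr, ← hY y hy]
    exact Fin.insertNth_self_removeNth i y
  have hre : ∀ y, r (e y) = y := fun y => by simp [he, hr]
  obtain ⟨c, hc1, hc2⟩ := hd (Y.image r) (l ∘ e) (Finset.card_image_le.trans hc) (by
    simp only [PairLabelled, Finset.mem_image, forall_exists_index, and_imp,
      forall_apply_eq_imp_iff₂, Function.comp]
    intro x hx y hy z hz
    rw [her x hx, her y hy, her z hz]
    intro h1 h2
    rcases hl x hx y hy z hz h1 h2 with h | h | h <;> simp [h])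
  refine ⟨c ∘ r, fun y hy => ?_, fun x hx y hy hxy => ?_⟩
  · have := hc1 (r y) (Finset.mem_image_of_mem _ hy)
    simpa [her y hy] using this
  · have := hc2 (r x) (Finset.mem_image_of_mem _ hx) (r y) (Finset.mem_image_of_mem _ hy)
      (by simpa [her x hx, her y hy] using hxy)
    let f : monoOn (cubeGraph d) c Set.univ →g monoOn (cubeGraph (d + 1)) (c ∘ r) {x | x i = b} :=
      { toFun := e
        map_rel' := by
          rintro u v ⟨⟨j, rfl⟩, h2, -, -⟩
          refine ⟨⟨i.succAbove j, ?_⟩, ?_, by simp [he], by simp [he]⟩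
          · simp only [he]; rw [flipAt_insertNth_succAbove]
          · simpa [hre] using h2 }
    have h := this.map f
    change (monoOn _ _ _).Reachable (e (r x)) (e (r y)) at h
    rwa [her x hx, her y hy] at h

/-- Linkages of the two facets in direction `i` combine. -/
theorem CubeLinked.two_facets {d : ℕ} (hd : CubeLinked d) (i : Fin (d + 1))
    (Z : Finset (Fin (d + 1) → Bool)) (l : (Fin (d + 1) → Bool) → ℕ)
    (hc : ∀ b, (Z.filter (fun z => z i = b)).card ≤ d + 1)
    (hl : ∀ b, PairLabelled (Z.filter (fun z => z i = b)) l) :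
    ∃ c : (Fin (d + 1) → Bool) → ℕ, (∀ z ∈ Z, c z = l z) ∧
      ∀ x ∈ Z, ∀ y ∈ Z, x i = y i → l x = l y →
        (monoOn (cubeGraph (d + 1)) c Set.univ).Reachable x y := by
  have key := fun b => hd.facet i b (Z.filter (fun z => z i = b)) l (by simp) (hc b) (hl b)
  choose c h1 h2 using key
  -- The facets are disjoint, so each vertex takes its colour from its own facet.
  refine ⟨fun x => c (x i) x, fun z hz => h1 (z i) z (by simp [hz]), fun x hx y hy hxy hlxy => ?_⟩
  refine (h2 (x i) x (by simp [hx]) y (by simp [hy, hxy]) hlxy).mono ?_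
  refine monoOn_le (Set.subset_univ _) (fun u hu => ?_)
  rw [show u i = x i from hu]

/-! ### Splitting the cube along a direction -/

set_option maxHeartbeats 800000 in
/-- Given exit points `q s` for the crossing vertices `s` of `X`, so that partners leave through
the same edge in direction `i`, the labelling is linkable if the facets are not too crowded. -/
theorem CubeLinked.linkable_of_exits {d : ℕ} (hd : CubeLinked d)
    {X : Finset (Fin (d + 1) → Bool)} {l : (Fin (d + 1) → Bool) → ℕ}
    {σ : (Fin (d + 1) → Bool) → (Fin (d + 1) → Bool)} (hσ : IsPartner X l σ)
    (hX : X.card ≤ d + 2) (i : Fin (d + 1)) (q : (Fin (d + 1) → Bool) → (Fin (d + 1) → Bool))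
    (hside : ∀ s ∈ X, σ s i ≠ s i → q s i = s i)
    (hflip : ∀ s ∈ X, σ s i ≠ s i → q (σ s) = flipAt (q s) i)
    (hinj : ∀ s ∈ X, σ s i ≠ s i → ∀ t ∈ X, σ t i ≠ t i → q s = q t → s = t)
    (hqX : ∀ s ∈ X, σ s i ≠ s i → q s ∈ X → q s = s)
    (hb : ∀ b, X.card ≤ d + 1 ∨ ∃ w ∈ X, w i ≠ b ∧ (σ w i = w i ∨ q (σ w) = σ w)) :
    Linkable (cubeGraph (d + 1)) Set.univ X l := by
  classical
  have hcr : ∀ s ∈ X, σ s i ≠ s i → σ s ∈ X ∧ σ (σ s) i ≠ σ s i := fun s hs h =>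
    ⟨hσ.mem s hs, by rw [hσ.invol s hs]; exact h.symm⟩
  set K := X.filter (fun s => σ s i ≠ s i) with hK
  have hKm : ∀ s, s ∈ K ↔ s ∈ X ∧ σ s i ≠ s i := fun s => by simp [hK]
  -- Exit points inherit the label of their crossing vertex; `hinj` and `hqX` prevent conflicts. The
  -- value 0 elsewhere is never used.
  obtain ⟨m, hmX, hmq⟩ : ∃ m : (Fin (d + 1) → Bool) → ℕ, (∀ x ∈ X, m x = l x) ∧
      ∀ s ∈ K, m (q s) = l s := by
    refine ⟨fun z => if z ∈ X then l z else if h : ∃ s ∈ K, q s = z then l h.choose else 0,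
      fun x hx => by simp [hx], fun s hs => ?_⟩
    have hs' := (hKm s).1 hs
    by_cases h : q s ∈ X
    · simp only [h, if_true]; rw [hqX s hs'.1 hs'.2 h]
    · have hex : ∃ t ∈ K, q t = q s := ⟨s, hs, rfl⟩
      simp only [h, if_false, dif_pos hex]
      have h1 := (hKm _).1 hex.choose_spec.1
      rw [hinj _ h1.1 h1.2 s hs'.1 hs'.2 hex.choose_spec.2]
  set Z := X ∪ K.image q with hZ
  have hZX : ∀ x ∈ X, x ∈ Z := fun x hx => by simp [hZ, hx]
  have hZq : ∀ s ∈ K, q s ∈ Z := fun s hs => by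
    rw [hZ]; exact Finset.mem_union_right _ (Finset.mem_image_of_mem _ hs)
  -- a vertex of `Z` sharing its label with a crossing vertex on its side
  have hZlab : ∀ s ∈ K, ∀ z ∈ Z, z i = s i → m z = l s → z = s ∨ z = q s := by
    intro s hs z hz hzi hzl
    have hs' := (hKm s).1 hs
    have aux : ∀ x ∈ X, x i = s i → l x = l s → x = s := by
      intro x hx hxi hxl
      rcases hσ.eq_or s hs'.1 x hx hxl.symm with h | h
      · exact h
      · rw [h] at hxi; exact absurd hxi hs'.2
    rcases Finset.mem_union.1 hz with h | h
    · exact Or.inl (aux z h hzi (by rw [← hmX z h, hzl]))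
    · obtain ⟨t, ht, rfl⟩ := Finset.mem_image.1 h
      have ht' := (hKm t).1 ht
      right
      rw [aux t ht'.1 (by rw [← hside t ht'.1 ht'.2, hzi]) (by rw [← hmq t ht, hzl])]
  obtain ⟨c, hc1, hc2⟩ := hd.two_facets i Z m (by
    intro b
    -- The extra terminals on side `b` are exits `q (σ w)`, charged to vertices `w` of `X` on the
    -- other side, so the facet holds at most `X.card` terminals. A single `w` that is charged
    -- nothing saves the one needed when `X.card = d + 2`.
    have hsub : Z.filter (fun z => z i = b) ⊆ X.filter (fun z => z i = b) ∪
        (X.filter (fun w => w i ≠ b ∧ ¬ (σ w i = w i ∨ q (σ w) = σ w))).image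
          (fun w => q (σ w)) := by
      intro z hz
      obtain ⟨hz, hzb⟩ := Finset.mem_filter.1 hz
      by_cases hzX : z ∈ X
      · exact Finset.mem_union_left _ (by simp [hzX, hzb])
      · rcases Finset.mem_union.1 hz with h | h
        · exact absurd h hzX
        · obtain ⟨t, ht, rfl⟩ := Finset.mem_image.1 h
          have ht' := (hKm t).1 ht
          refine Finset.mem_union_right _ (Finset.mem_image.2 ⟨σ t, ?_, by rw [hσ.invol t ht'.1]⟩)
          have hti : t i = b := by rw [← hside t ht'.1 ht'.2, hzb]
          refine Finset.mem_filter.2 ⟨hσ.mem t ht'.1, by rw [← hti]; exact ht'.2, ?_⟩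
          rw [hσ.invol t ht'.1]
          rintro (h1 | h1)
          · exact ht'.2 h1.symm
          · rw [h1] at hzX; exact hzX ht'.1
    have h1 := (Finset.card_le_card hsub).trans (Finset.card_union_le _ _)
    have h2 : ((X.filter (fun w => w i ≠ b ∧ ¬ (σ w i = w i ∨ q (σ w) = σ w))).image
        (fun w => q (σ w))).card ≤
        (X.filter (fun w => w i ≠ b ∧ ¬ (σ w i = w i ∨ q (σ w) = σ w))).card :=
      Finset.card_image_le
    have h3 := Finset.card_filter_add_card_filter_not (s := X) (fun z => z i = b)
    have h4 : X.filter (fun w => w i ≠ b ∧ ¬ (σ w i = w i ∨ q (σ w) = σ w)) ⊆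
        X.filter (fun w => ¬ w i = b) := by
      intro w hw; simp only [Finset.mem_filter] at hw ⊢; exact ⟨hw.1, hw.2.1⟩
    rcases hb b with h5 | ⟨w, hw, hwb, hww⟩
    · have := Finset.card_le_card h4
      omega
    · have : X.filter (fun w => w i ≠ b ∧ ¬ (σ w i = w i ∨ q (σ w) = σ w)) ⊂
          X.filter (fun w => ¬ w i = b) := by
        refine Finset.ssubset_iff_subset_ne.2 ⟨h4, fun e => ?_⟩
        have h6 : w ∈ X.filter (fun w => ¬ w i = b) := by simp [hw, hwb]
        rw [← e] at h6
        exact (Finset.mem_filter.1 h6).2.2 hww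
      have := Finset.card_lt_card this
      omega) (by
    intro b x hx y hy z hz hxy hxz
    obtain ⟨hx, hxb⟩ := Finset.mem_filter.1 hx
    obtain ⟨hy, hyb⟩ := Finset.mem_filter.1 hy
    obtain ⟨hz, hzb⟩ := Finset.mem_filter.1 hz
    -- On one side, the label of a crossing vertex `s` occurs only at `s` and `q s`; any other label
    -- occurs only on `X`.
    by_cases hs : ∃ s ∈ K, s i = b ∧ l s = m x
    · obtain ⟨s, hs, hsb, hsl⟩ := hs
      have e1 := hZlab s hs x hx (by rw [hxb, hsb]) hsl.symm
      have e2 := hZlab s hs y hy (by rw [hyb, hsb]) (by rw [hsl, hxy])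
      have e3 := hZlab s hs z hz (by rw [hzb, hsb]) (by rw [hsl, hxz])
      rcases e1 with e1 | e1 <;> rcases e2 with e2 | e2 <;> rcases e3 with e3 | e3 <;>
        first
        | exact Or.inl (e1.trans e2.symm)
        | exact Or.inr (Or.inl (e1.trans e3.symm))
        | exact Or.inr (Or.inr (e2.trans e3.symm))
    · have aux : ∀ u ∈ Z, u i = b → m x = m u → u ∈ X := by
        intro u hu hub hul
        rcases Finset.mem_union.1 hu with h | h
        · exact h
        · obtain ⟨t, ht, rfl⟩ := Finset.mem_image.1 h
          have ht' := (hKm t).1 ht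
          exact absurd ⟨t, ht, by rw [← hside t ht'.1 ht'.2, hub], by rw [hul, hmq t ht]⟩ hs
      have hx' := aux x hx hxb rfl
      have hy' := aux y hy hyb hxy
      have hz' := aux z hz hzb hxz
      rw [hmX x hx', hmX y hy'] at hxy
      rw [hmX x hx', hmX z hz'] at hxz
      rcases hσ.eq_or x hx' y hy' hxy with h | h
      · exact Or.inl h.symm
      · rcases hσ.eq_or x hx' z hz' hxz with h' | h'
        · exact Or.inr (Or.inl h'.symm)
        · exact Or.inr (Or.inr (h.trans h'.symm)))
  have hcX : ∀ x ∈ X, c x = l x := fun x hx => by rw [hc1 x (hZX x hx), hmX x hx]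
  refine ⟨c, hcX, fun x hx y hy hxy => ?_⟩
  by_cases hi : x i = y i
  · exact hc2 x (hZX x hx) y (hZX y hy) hi (by rw [hmX x hx, hmX y hy, hxy])
  · have hy' : y = σ x := by
      rcases hσ.eq_or x hx y hy hxy with h | h
      · exact absurd (by rw [h]) hi
      · exact h
    subst hy'
    have hxc : σ x i ≠ x i := fun h => hi h.symm
    have hxK : x ∈ K := (hKm x).2 ⟨hx, hxc⟩
    have hyK : σ x ∈ K := (hKm _).2 (hcr x hx hxc)
    have hy2 := (hKm _).1 hyK
    have r1 := hc2 x (hZX x hx) (q x) (hZq x hxK) (hside x hx hxc).symm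
      (by rw [hmX x hx, hmq x hxK])
    have r2 := hc2 (q (σ x)) (hZq _ hyK) (σ x) (hZX _ hy) (hside _ hy2.1 hy2.2)
      (by rw [hmX _ hy, hmq _ hyK])
    refine (r1.trans (SimpleGraph.Adj.reachable ?_)).trans r2
    refine ⟨?_, ?_, trivial, trivial⟩
    · rw [hflip x hx hxc]; exact cubeGraph_adj_flipAt _ _
    · rw [hc1 _ (hZq x hxK), hc1 _ (hZq _ hyK), hmq x hxK, hmq _ hyK, hσ.label x hx]

theorem two_mul_add_two_le_two_pow {d : ℕ} (hd : 4 ≤ d) : 2 * (d + 2) ≤ 2 ^ d := by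
  induction d, hd using Nat.le_induction with
  | base => norm_num
  | succ n _ ih => rw [pow_succ]; omega

/-- `R` is a set of crossing vertices that leave their facet at once. -/
theorem CubeLinked.linkable_of_released {d : ℕ} (hd : CubeLinked d) (hd4 : 4 ≤ d)
    {X : Finset (Fin (d + 1) → Bool)} {l : (Fin (d + 1) → Bool) → ℕ}
    {σ : (Fin (d + 1) → Bool) → (Fin (d + 1) → Bool)} (hσ : IsPartner X l σ)
    (hX : X.card ≤ d + 2) (i : Fin (d + 1)) (R : Finset (Fin (d + 1) → Bool))
    (hR : ∀ a ∈ R, flipAt a i ∈ X → flipAt a i = σ a)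
    (hRR : ∀ a ∈ R, σ a ∈ R → flipAt a i = σ a)
    (hb : ∀ b, X.card ≤ d + 1 ∨ ∃ w ∈ X, w i ≠ b ∧
      (σ w i = w i ∨ σ w ∈ R ∨ (w ∈ R ∧ flipAt w i = σ w))) :
    Linkable (cubeGraph (d + 1)) Set.univ X l := by
  classical
  -- edges in direction `i` away from `X`
  set B : Finset (Fin d → Bool) := Finset.univ \ X.image (fun x => i.removeNth x) with hB
  have hBX : ∀ y ∈ B, ∀ b, (i.insertNth b y : Fin (d + 1) → Bool) ∉ X := by
    intro y hy b hX'
    have := (Finset.mem_sdiff.1 hy).2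
    exact this (Finset.mem_image.2 ⟨_, hX', by simp⟩)
  -- `X` meets at most `d + 2` of the `2 ^ d` edges in direction `i`, and at most `d + 2` labels
  -- need an edge of their own.
  have hcard : (X.image l).card ≤ B.card := by
    have h1 : (Finset.univ : Finset (Fin d → Bool)).card = 2 ^ d := by simp
    have h2 := Finset.le_card_sdiff (X.image (fun x => i.removeNth x))
      (Finset.univ : Finset (Fin d → Bool))
    have h3 : (X.image (fun x => i.removeNth x)).card ≤ X.card := Finset.card_image_le
    have h4 : (X.image l).card ≤ X.card := Finset.card_image_le
    have h5 := two_mul_add_two_le_two_pow hd4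
    rw [hB]
    rw [h1] at h2
    omega
  obtain ⟨g, hgB, hginj⟩ : ∃ g : ℕ → (Fin d → Bool), (∀ k ∈ X.image l, g k ∈ B) ∧
      Set.InjOn g (X.image l) := by
    obtain ⟨g, h1, h2⟩ := (X.image l).finite_toSet.exists_injOn_of_encard_le
      (t := (B : Set (Fin d → Bool))) (by
        rw [Set.encard_coe_eq_coe_finsetCard, Set.encard_coe_eq_coe_finsetCard]
        exact_mod_cast hcard)
    exact ⟨g, fun k hk => h1 (Finset.mem_coe.2 hk), h2⟩
  have hgm : ∀ s ∈ X, g (l s) ∈ B := fun s hs => hgB _ (Finset.mem_image_of_mem _ hs)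
  have hbool : ∀ s, σ s i ≠ s i → σ s i = !s i := fun s h => by
    cases h1 : σ s i <;> cases h2 : s i <;> simp_all
  have hgX : ∀ s ∈ X, ∀ b, (i.insertNth b (g (l s)) : Fin (d + 1) → Bool) ∉ X :=
    fun s hs => hBX _ (hgm s hs)
  -- A released vertex is its own exit, its partner exits at the other end of that edge, and every
  -- remaining pair uses the free edge reserved for its label.
  refine hd.linkable_of_exits hσ hX i (fun s => if s ∈ R then s else if σ s ∈ R then
    flipAt (σ s) i else i.insertNth (s i) (g (l s))) ?_ ?_ ?_ ?_ ?_
  · intro s hs hsc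
    split_ifs
    · rfl
    · rw [flipAt_same, hbool s hsc]; simp
    · simp
  · intro s hs hsc
    rw [hσ.invol s hs, hσ.label s hs]
    by_cases h1 : s ∈ R <;> by_cases h2 : σ s ∈ R
    · simp [h1, h2, hRR s h1 h2]
    · simp [h1, h2]
    · simp [h1, h2]
    · simp only [h1, h2, if_false]
      rw [flipAt_insertNth, hbool s hsc]
  · intro s hs hsc t ht htc
    have aux : ∀ s ∈ X, ∀ t ∈ X, t ∉ R → σ t ∈ R → s = flipAt (σ t) i → s = t := by
      intro s hs t ht h2 h3 h
      rw [h, hR _ h3 (h ▸ hs), hσ.invol t ht]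
    have aux2 : ∀ s ∈ X, ∀ t ∈ X, ∀ b, flipAt (σ t) i ≠ i.insertNth b (g (l s)) := by
      intro s hs t ht b h
      have h' := congrArg (fun z => flipAt z i) h
      simp only [flipAt_flipAt, flipAt_insertNth] at h'
      exact hgX s hs _ (h' ▸ hσ.mem t ht)
    split_ifs with h1 h2 h3 h4 h5 h6 h7 h8
    · exact id
    · exact aux s hs t ht h2 h3
    · intro h; exact absurd (h ▸ hs) (hgX t ht _)
    · intro h; exact (aux t ht s hs h1 h4 h.symm).symm
    · intro h
      have h' := flipAt_injective i h
      rw [← hσ.invol s hs, h', hσ.invol t ht]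
    · intro h; exact absurd h (aux2 t ht s hs _)
    · intro h; exact absurd (h ▸ ht) (hgX s hs _)
    · intro h; exact absurd h.symm (aux2 s hs t ht _)
    · intro h
      have h1 : s i = t i := by simpa using congrFun h i
      rw [h1] at h
      have h2 : g (l s) = g (l t) := by
        simpa using congrArg (fun z => i.removeNth z) h
      have h3 := hginj (Finset.mem_coe.2 (Finset.mem_image_of_mem _ hs))
        (Finset.mem_coe.2 (Finset.mem_image_of_mem _ ht)) h2
      rcases hσ.eq_or s hs t ht h3 with h | h
      · exact h.symm
      · rw [h] at h1; exact absurd h1.symm hsc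
  · intro s hs hsc
    split_ifs with h1 h2
    · exact fun _ => rfl
    · intro h; rw [hR _ h2 h, hσ.invol s hs]
    · intro h; exact absurd h (hgX s hs _)
  · intro b
    rcases hb b with h | ⟨w, hw, hwb, h | h | ⟨h1, h2⟩⟩
    · exact Or.inl h
    · exact Or.inr ⟨w, hw, hwb, Or.inl h⟩
    · exact Or.inr ⟨w, hw, hwb, Or.inr (by simp [h])⟩
    · refine Or.inr ⟨w, hw, hwb, Or.inr ?_⟩
      rw [hσ.invol w hw]
      split_ifs
      · rfl
      · exact h2

/-! ### Terminals contained in a facet -/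

/-- The walk is cut at its first arrival at `v`. -/
theorem exists_adj_of_reachable {V : Type*} {G : SimpleGraph V} {c : V → ℕ} {A : Set V} {s v : V}
    (h : (monoOn G c A).Reachable s v) (hs : s ≠ v) :
    ∃ a, (monoOn G c A).Adj a v ∧ (monoOn G c (A \ {v})).Reachable s a := by
  obtain ⟨w⟩ := h
  induction w with
  | nil => exact absurd rfl hs
  | @cons s u v h p ih =>
    by_cases hu : u = v
    · subst hu; exact ⟨s, h, SimpleGraph.Reachable.refl _⟩
    · obtain ⟨a, ha, hr⟩ := ih hu
      refine ⟨a, ha, (SimpleGraph.Adj.reachable ?_).trans hr⟩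
      exact ⟨h.1, h.2.1, ⟨h.2.2.1, hs⟩, ⟨h.2.2.2, hu⟩⟩

theorem reachable_sdiff_of_not_reachable {V : Type*} {G : SimpleGraph V} {c : V → ℕ} {A : Set V}
    {s t v : V} (h : (monoOn G c A).Reachable s t) (hv : ¬ (monoOn G c A).Reachable s v) :
    (monoOn G c (A \ {v})).Reachable s t := by
  obtain ⟨w⟩ := h
  induction w with
  | nil => exact SimpleGraph.Reachable.refl _
  | @cons s u t h p ih =>
    have hu : ¬ (monoOn G c A).Reachable u v := fun hr => hv (h.reachable.trans hr)
    refine (SimpleGraph.Adj.reachable ?_).trans (ih hu)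
    refine ⟨h.1, h.2.1, ⟨h.2.2.1, ?_⟩, ⟨h.2.2.2, ?_⟩⟩
    · rintro rfl; exact hv (SimpleGraph.Reachable.refl _)
    · rintro rfl; exact hu (SimpleGraph.Reachable.refl _)

/-- A connection either avoids `v` or passes through `v` between two of its neighbours. -/
theorem reachable_sdiff_or {V : Type*} {G : SimpleGraph V} {c : V → ℕ} {A : Set V} {s t v : V}
    (h : (monoOn G c A).Reachable s t) (hs : s ≠ v) (ht : t ≠ v) :
    (monoOn G c (A \ {v})).Reachable s t ∨ ∃ a b, a ≠ b ∧ (monoOn G c A).Adj a v ∧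
      (monoOn G c A).Adj b v ∧ (monoOn G c (A \ {v})).Reachable s a ∧
      (monoOn G c (A \ {v})).Reachable t b := by
  by_cases hv : (monoOn G c A).Reachable s v
  · obtain ⟨a, ha, hsa⟩ := exists_adj_of_reachable hv hs
    obtain ⟨b, hb, htb⟩ := exists_adj_of_reachable (h.symm.trans hv) ht
    by_cases hab : a = b
    · subst hab; exact Or.inl (hsa.trans htb.symm)
    · exact Or.inr ⟨a, b, hab, ha, hb, hsa, htb⟩
  · exact Or.inl (reachable_sdiff_of_not_reachable h hv)

/-- If all terminals lie in one facet, one pair is joined in the opposite facet, and a path of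
the facet using one of its ends is rerouted through the opposite facet. -/
theorem CubeLinked.linkable_of_facet {d : ℕ} (hd : CubeLinked d) (hd3 : 3 ≤ d)
    {X : Finset (Fin (d + 1) → Bool)} {l : (Fin (d + 1) → Bool) → ℕ}
    {σ : (Fin (d + 1) → Bool) → (Fin (d + 1) → Bool)} (hσ : IsPartner X l σ)
    (hX : X.card ≤ d + 2) (i : Fin (d + 1)) (b : Bool) (hXb : ∀ x ∈ X, x i = b) :
    Linkable (cubeGraph (d + 1)) Set.univ X l := by
  classical
  by_cases hpair : ∃ s ∈ X, σ s ≠ s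
  swap
  · push Not at hpair
    refine ⟨l, fun _ _ => rfl, fun x hx y hy hxy => ?_⟩
    have : y = x := by
      rcases hσ.eq_or x hx y hy hxy with h | h
      · exact h
      · rw [h, hpair x hx]
    rw [this]
  obtain ⟨s, hs, hst⟩ := hpair
  obtain ⟨t, ht⟩ : ∃ t, t = σ s := ⟨_, rfl⟩
  rw [← ht] at hst
  have htX : t ∈ X := ht ▸ hσ.mem s hs
  have htσ : σ t = s := by rw [ht, hσ.invol s hs]
  have hlt : l t = l s := by rw [ht, hσ.label s hs]
  have hsY : s ∈ X.erase t := Finset.mem_erase.2 ⟨hst.symm, hs⟩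
  -- Dropping `t` leaves at most `d + 1` terminals, within reach of `hd`. The colour that `c₀` gives
  -- to `t` is uncontrolled.
  obtain ⟨c₀, hc1, hc2⟩ := hd.facet i b (X.erase t) l
    (fun y hy => hXb y (Finset.mem_of_mem_erase hy))
    (by rw [Finset.card_erase_of_mem htX]; omega) (by
      intro x hx y hy z hz hxy hxz
      replace hx := Finset.mem_of_mem_erase hx
      replace hy := Finset.mem_of_mem_erase hy
      replace hz := Finset.mem_of_mem_erase hz
      rcases hσ.eq_or x hx y hy hxy with h | h
      · exact Or.inl h.symm
      · rcases hσ.eq_or x hx z hz hxz with h' | h'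
        · exact Or.inr (Or.inl h'.symm)
        · exact Or.inr (Or.inr (h.trans h'.symm)))
  set A : Set (Fin (d + 1) → Bool) := {x | x i = b} with hA
  set A' : Set (Fin (d + 1) → Bool) := {x | x i = !b} with hA'
  set G := cubeGraph (d + 1) with hG
  -- `t` regains its label, the rest of its facet keeps `c₀`, and the opposite facet receives a
  -- colouring `c₁` chosen later.
  set C : ((Fin (d + 1) → Bool) → ℕ) → (Fin (d + 1) → Bool) → ℕ := fun c₁ v =>
    if v = t then l s else if v i = b then c₀ v else c₁ v with hC
  have le0 : ∀ c₁, monoOn G c₀ (A \ {t}) ≤ monoOn G (C c₁) Set.univ := by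
    intro c₁
    refine monoOn_le (Set.subset_univ _) (fun u hu => ?_)
    have h1 : u i = b := hu.1
    have h2 : u ≠ t := hu.2
    simp [hC, h1, h2]
  have hA't : ∀ u, u i = (!b) → u ≠ t ∧ u i ≠ b := by
    intro u hu
    have : u i ≠ b := by rw [hu]; simp
    exact ⟨fun h => this (h ▸ hXb t htX), this⟩
  have le1 : ∀ c₁, monoOn G c₁ A' ≤ monoOn G (C c₁) Set.univ := by
    intro c₁
    refine monoOn_le (Set.subset_univ _) (fun u hu => ?_)
    have h := hA't u hu
    simp [hC, h.1, h.2]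
  have hflip : ∀ u, u i = b → flipAt u i i = !b := fun u hu => by simp [hu]
  have cross : ∀ c₁ u, u i = b → C c₁ u = c₁ (flipAt u i) →
      (monoOn G (C c₁) Set.univ).Reachable u (flipAt u i) := by
    intro c₁ u hu hcu
    refine SimpleGraph.Adj.reachable ⟨cubeGraph_adj_flipAt u i, ?_, trivial, trivial⟩
    have h := hA't _ (hflip u hu)
    rw [hcu]; simp [hC, h.1, hu]
  have hC0 : ∀ c₁ u, u i = b → u ≠ t → C c₁ u = c₀ u := fun c₁ u h1 h2 => by simp [hC, h1, h2]
  have hCt : ∀ c₁, C c₁ t = l s := fun c₁ => by simp [hC]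
  have finish : ∀ c₁, c₁ (flipAt s i) = l s → c₁ (flipAt t i) = l s →
      (monoOn G c₁ A').Reachable (flipAt s i) (flipAt t i) →
      (∀ x ∈ X.erase t, ∀ y ∈ X.erase t, l x = l y → x ≠ y →
        (monoOn G (C c₁) Set.univ).Reachable x y) → Linkable G Set.univ X l := by
    intro c₁ h1 h2 h3 h4
    have hst' : (monoOn G (C c₁) Set.univ).Reachable s t :=
      ((cross c₁ s (hXb s hs) (by rw [hC0 c₁ s (hXb s hs) hst.symm, h1, hc1 s hsY])).trans
        (h3.mono (le1 c₁))).trans (cross c₁ t (hXb t htX) (by rw [hCt, h2])).symm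
    have hnt : ∀ x ∈ X, x ≠ t → l x = l t → x = s := by
      intro x hx hxt hl
      rcases hσ.eq_or t htX x hx hl.symm with h | h
      · exact absurd h hxt
      · rw [h, htσ]
    refine ⟨C c₁, fun y hy => ?_, fun x hx y hy hxy => ?_⟩
    · by_cases hyt : y = t
      · rw [hyt, hCt, hlt]
      · rw [hC0 c₁ y (hXb y hy) hyt, hc1 y (Finset.mem_erase.2 ⟨hyt, hy⟩)]
    · by_cases hxy' : x = y
      · rw [hxy']
      by_cases hxt : x = t
      · have hyt : y ≠ t := fun h => hxy' (hxt.trans h.symm)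
        rw [hnt y hy hyt (by rw [← hxy, hxt]), hxt]
        exact hst'.symm
      · by_cases hyt : y = t
        · rw [hnt x hx hxt (by rw [hxy, hyt]), hyt]
          exact hst'
        · exact h4 x (Finset.mem_erase.2 ⟨hxt, hx⟩) y (Finset.mem_erase.2 ⟨hyt, hy⟩) hxy hxy'
  have hfi : ∀ u v : Fin (d + 1) → Bool, flipAt u i = flipAt v i → u = v :=
    fun u v h => flipAt_injective i h
  by_cases hall : ∀ x ∈ X.erase t, ∀ y ∈ X.erase t, l x = l y →
      (monoOn G c₀ (A \ {t})).Reachable x y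
  · obtain ⟨c₁, h1, h2⟩ := hd.facet i (!b) {flipAt s i, flipAt t i} (fun _ => l s)
      (by
        intro y hy
        simp only [Finset.mem_insert, Finset.mem_singleton] at hy
        rcases hy with rfl | rfl
        · exact hflip s (hXb s hs)
        · exact hflip t (hXb t htX))
      (Finset.card_le_two.trans (by omega)) (by
        intro x hx y hy z hz _ _
        simp only [Finset.mem_insert, Finset.mem_singleton] at hx hy hz
        rcases hx with rfl | rfl <;> rcases hy with rfl | rfl <;> rcases hz with rfl | rfl <;> simp)
    exact finish c₁ (h1 _ (by simp)) (h1 _ (by simp)) (h2 _ (by simp) _ (by simp) rfl)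
      (fun x hx y hy hxy _ => (hall x hx y hy hxy).mono (le0 c₁))
  · push Not at hall
    obtain ⟨x, hx, y, hy, hxy, hnr⟩ := hall
    have hxt := Finset.ne_of_mem_erase hx
    have hyt := Finset.ne_of_mem_erase hy
    rcases reachable_sdiff_or (hc2 x hx y hy hxy) hxt hyt with h | ⟨a, a', haa, ha, ha', hxa, hya⟩
    · exact absurd h hnr
    have hxney : x ≠ y := by rintro rfl; exact hnr (SimpleGraph.Reachable.refl _)
    have hca : c₀ a = l x := by rw [← color_eq_of_reachable hxa, hc1 x hx]
    have hca' : c₀ a' = l x := by rw [← color_eq_of_reachable hya, hc1 y hy, hxy]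
    have hct : c₀ t = l x := by rw [← ha.2.1, hca]
    -- With `t` removed, `s` is alone in its class, so the connection broken at `t` belongs to
    -- another pair.
    have hls : l x ≠ l s := by
      intro h
      have aux : ∀ z ∈ X.erase t, l z = l s → z = s := by
        intro z hz hzl
        rcases hσ.eq_or s hs z (Finset.mem_of_mem_erase hz) hzl.symm with h | h
        · exact h
        · rw [← ht] at h; exact absurd h (Finset.ne_of_mem_erase hz)
      exact hxney ((aux x hx h).trans (aux y hy (hxy ▸ h)).symm)
    have hat : a ≠ t := ha.1.ne
    have hat' : a' ≠ t := ha'.1.ne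
    have has : a ≠ s := by rintro rfl; rw [hc1 _ hsY] at hca; exact hls hca.symm
    have has' : a' ≠ s := by rintro rfl; rw [hc1 _ hsY] at hca'; exact hls hca'.symm
    have hab : a i = b := ha.2.2.1
    have hab' : a' i = b := ha'.2.2.1
    -- Two pairs are linked in the opposite facet: the shifted `s`, `t`, and the shifted neighbours
    -- of `t` between which the path from `x` to `y` is interrupted. These four terminals require `3
    -- ≤ d`.
    set m : (Fin (d + 1) → Bool) → ℕ :=
      fun z => if z = flipAt a i ∨ z = flipAt a' i then l x else l s with hm
    have m1 : m (flipAt s i) = l s := by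
      simp only [hm]; rw [if_neg]
      rintro (h | h)
      · exact has (hfi _ _ h).symm
      · exact has' (hfi _ _ h).symm
    have m2 : m (flipAt t i) = l s := by
      simp only [hm]; rw [if_neg]
      rintro (h | h)
      · exact hat (hfi _ _ h).symm
      · exact hat' (hfi _ _ h).symm
    have m3 : m (flipAt a i) = l x := by simp [hm]
    have m4 : m (flipAt a' i) = l x := by simp [hm]
    obtain ⟨c₁, h1, h2⟩ := hd.facet i (!b) {flipAt s i, flipAt t i, flipAt a i, flipAt a' i} m
      (by
        intro y hy
        simp only [Finset.mem_insert, Finset.mem_singleton] at hy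
        rcases hy with rfl | rfl | rfl | rfl
        · exact hflip s (hXb s hs)
        · exact hflip t (hXb t htX)
        · exact hflip a hab
        · exact hflip a' hab')
      (Finset.card_le_four.trans (by omega)) (by
        have hls' := hls.symm
        intro x' hx' y' hy' z' hz'
        simp only [Finset.mem_insert, Finset.mem_singleton] at hx' hy' hz'
        rcases hx' with h1 | h1 | h1 | h1 <;> rcases hy' with h2 | h2 | h2 | h2 <;>
          rcases hz' with h3 | h3 | h3 | h3 <;> rw [h1, h2, h3] <;>
          simp only [m1, m2, m3, m4, hls, hls', true_or, or_true, false_imp_iff, imp_true_iff])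
    refine finish c₁ (by rw [h1 _ (by simp), m1]) (by rw [h1 _ (by simp), m2])
      (h2 _ (by simp) _ (by simp) (by rw [m1, m2])) ?_
    have hxy2 : (monoOn G (C c₁) Set.univ).Reachable x y := by
      have r1 := cross c₁ a hab (by rw [hC0 c₁ a hab hat, h1 _ (by simp), m3, hca])
      have r2 := cross c₁ a' hab' (by rw [hC0 c₁ a' hab' hat', h1 _ (by simp), m4, hca'])
      have r3 := (h2 (flipAt a i) (by simp) (flipAt a' i) (by simp) (by rw [m3, m4])).mono (le1 c₁)
      exact ((hxa.mono (le0 c₁)).trans r1).trans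
        ((r3.trans r2.symm).trans (hya.mono (le0 c₁)).symm)
    intro u hu v hv huv huv'
    -- Only the colour of `t` is disturbed by its removal, and that is the colour of the pair `x`,
    -- `y`.
    by_cases hr : (monoOn G c₀ A).Reachable u t
    · have hul : l u = l x := by rw [← hc1 u hu, color_eq_of_reachable hr, hct]
      have hux := hσ.eq_or x (Finset.mem_of_mem_erase hx) u (Finset.mem_of_mem_erase hu) hul.symm
      have hvx := hσ.eq_or x (Finset.mem_of_mem_erase hx) v (Finset.mem_of_mem_erase hv)
        (hul.symm.trans huv)
      have hyx := hσ.eq_or x (Finset.mem_of_mem_erase hx) y (Finset.mem_of_mem_erase hy) hxy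
      have hy' : y = σ x := hyx.resolve_left (fun h => hxney h.symm)
      rw [← hy'] at hux hvx
      rcases hux with rfl | rfl <;> rcases hvx with rfl | rfl
      · exact absurd rfl huv'
      · exact hxy2
      · exact hxy2.symm
      · exact absurd rfl huv'
    · exact (reachable_sdiff_of_not_reachable (hc2 u hu v hv huv) hr).mono (le0 c₁)

/-! ### Choosing a direction -/

theorem flipAt_right_injective {d : ℕ} (x : Fin d → Bool) :
    Function.Injective (fun i => flipAt x i) := by
  intro j k hjk
  by_contra hne
  have : flipAt x j j = flipAt x k j := congrFun hjk j
  rw [flipAt_same, flipAt_of_ne _ hne] at this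
  simp at this

/-- A nonempty set from which one can always move closer to `w` contains `w`. -/
theorem mem_of_flipAt_closed {d : ℕ} {M : Finset (Fin d → Bool)} {w : Fin d → Bool}
    (hne : M.Nonempty) (h : ∀ x ∈ M, ∀ j, x j ≠ w j → flipAt x j ∈ M) : w ∈ M := by
  obtain ⟨x, hx, hmin⟩ := M.exists_min_image
    (fun x => (Finset.univ.filter (fun j => x j ≠ w j)).card) hne
  by_cases hxw : x = w
  · exact hxw ▸ hx
  obtain ⟨j, hj⟩ := Function.ne_iff.1 hxw
  refine absurd (hmin _ (h x hx j hj)) (not_le.2 (Finset.card_lt_card ?_))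
  refine Finset.ssubset_iff_of_subset ?_ |>.2 ⟨j, by simpa using hj, ?_⟩
  · intro k hk
    simp only [Finset.mem_filter, Finset.mem_univ, true_and] at hk ⊢
    by_cases hkj : k = j
    · rw [hkj]; exact hj
    · rwa [flipAt_of_ne _ hkj] at hk
  · simp only [Finset.mem_filter, Finset.mem_univ, true_and, flipAt_same, ne_eq, not_not]
    revert hj
    cases x j <;> cases w j <;> simp

/-- The flip injects `S` into `M` and `σ` injects `M` into `S`, so the flip maps `S` onto `M`; it is
its own inverse. -/
theorem flipAt_mem_of_injOn {d : ℕ} {M S : Finset (Fin d → Bool)} {i : Fin d}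
    {σ : (Fin d → Bool) → (Fin d → Bool)} (hσ : ∀ y ∈ M, σ y ∈ S) (hinj : Set.InjOn σ M)
    (h : ∀ s ∈ S, flipAt s i ∈ M) : ∀ y ∈ M, flipAt y i ∈ S := by
  classical
  intro y hy
  have h1 : S.image (fun s => flipAt s i) = M := by
    refine Finset.eq_of_subset_of_card_le (fun z hz => ?_) ?_
    · obtain ⟨s, hs, rfl⟩ := Finset.mem_image.1 hz
      exact h s hs
    · rw [Finset.card_image_of_injective _ (flipAt_injective i)]
      exact Finset.card_le_card_of_injOn σ hσ hinj
  rw [← h1] at hy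
  obtain ⟨s, hs, rfl⟩ := Finset.mem_image.1 hy
  simpa using hs

/-- Sets of `d + 1` vertices with an involution that obstruct splitting in every direction. -/
structure IsObstruction {d : ℕ} (X : Finset (Fin d → Bool))
    (σ : (Fin d → Bool) → (Fin d → Bool)) : Prop where
  card : X.card = d + 1
  mem : ∀ x ∈ X, σ x ∈ X
  invol : ∀ x ∈ X, σ (σ x) = x
  sep : ∀ i b, ∃ x ∈ X, x i = b
  same_side : ∀ i, ∀ x ∈ X, ∀ y ∈ X, σ x i = x i → σ y i = y i → x i = y i
  flip_mem : ∀ i, ∀ x ∈ X, ∀ s ∈ X, σ x i = x i → σ s i ≠ s i → s i = x i → flipAt s i ∈ X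
  flip_ne : ∀ i, ∀ s ∈ X, σ s i ≠ s i → flipAt s i ≠ σ s
  flip_or : ∀ i, ∀ s ∈ X, ∀ t ∈ X, σ s i ≠ s i → σ t i ≠ t i → s i ≠ t i → t ≠ σ s →
    flipAt s i ∉ X → flipAt t i ∈ X

/-! ### Excluding obstructions -/

namespace IsObstruction

variable {d : ℕ} {X : Finset (Fin d → Bool)} {σ : (Fin d → Bool) → (Fin d → Bool)}

theorem injOn (h : IsObstruction X σ) : Set.InjOn σ X := by
  intro x hx y hy hxy
  rw [← h.invol x hx, hxy, h.invol y hy]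

/-- Opposite `x` every vertex crosses, and `σ` injects these vertices into the crossing ones on the
side of `x`, whose flips lie in `X` by `flip_mem`. Equal cardinalities make the flip a bijection
between the two sets. -/
theorem flip_mem_of_ne (h : IsObstruction X σ) {i : Fin d} {x y : Fin d → Bool} (hx : x ∈ X)
    (hxi : σ x i = x i) (hy : y ∈ X) (hyi : y i ≠ x i) : flipAt y i ∈ X := by
  have hcr : ∀ z ∈ X, z i ≠ x i → σ z i ≠ z i := fun z hz hzi e =>
    hzi (h.same_side i z hz x hx e hxi)
  have key := flipAt_mem_of_injOn (M := X.filter (fun z => z i ≠ x i))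
    (S := X.filter (fun z => z i = x i ∧ σ z i ≠ z i)) (i := i) (σ := σ) (by
      intro z hz
      obtain ⟨hz, hzi⟩ := Finset.mem_filter.1 hz
      have := hcr z hz hzi
      refine Finset.mem_filter.2 ⟨h.mem z hz, ?_, ?_⟩
      · revert hzi this
        cases z i <;> cases x i <;> cases σ z i <;> simp
      · rw [h.invol z hz]; exact this.symm)
    (h.injOn.mono (by intro z hz; exact (Finset.mem_filter.1 (Finset.mem_coe.1 hz)).1)) (by
      intro z hz
      obtain ⟨hz, hzi, hzc⟩ := Finset.mem_filter.1 hz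
      refine Finset.mem_filter.2 ⟨h.flip_mem i x hx z hz hxi hzc hzi, ?_⟩
      rw [flipAt_same, hzi]; simp)
  exact (Finset.mem_filter.1 (key y (Finset.mem_filter.2 ⟨hy, hyi⟩))).1

theorem flip_mem_of_crossing (h : IsObstruction X σ) {i : Fin d} {x y : Fin d → Bool}
    (hx : x ∈ X) (hxi : σ x i = x i) (hy : y ∈ X) (hyi : σ y i ≠ y i) : flipAt y i ∈ X := by
  by_cases hyx : y i = x i
  · exact h.flip_mem i x hx y hy hxi hyi hyx
  · exact h.flip_mem_of_ne hx hxi hy hyx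

/-- If all flips from the side opposite `s` lay in `X`, comparing the two sides through `σ` would
put the flip of `s` in `X` too. So some opposite vertex has its flip outside `X`, and `flip_or`
leaves only `σ s`. -/
theorem flip_partner_not_mem (h : IsObstruction X σ) {i : Fin d}
    (hi : ∀ x ∈ X, σ x i ≠ x i) {s : Fin d → Bool} (hs : s ∈ X) (hsi : flipAt s i ∉ X) :
    flipAt (σ s) i ∉ X := by
  have hex : ∃ u ∈ X, u i ≠ s i ∧ flipAt u i ∉ X := by
    by_contra hcon
    push Not at hcon
    have key := flipAt_mem_of_injOn (M := X.filter (fun z => z i = s i))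
      (S := X.filter (fun z => z i ≠ s i)) (i := i) (σ := σ) (by
        intro z hz
        obtain ⟨hz, hzi⟩ := Finset.mem_filter.1 hz
        exact Finset.mem_filter.2 ⟨h.mem z hz, by rw [← hzi]; exact hi z hz⟩)
      (h.injOn.mono (by intro z hz; exact (Finset.mem_filter.1 (Finset.mem_coe.1 hz)).1)) (by
        intro z hz
        obtain ⟨hz, hzi⟩ := Finset.mem_filter.1 hz
        refine Finset.mem_filter.2 ⟨hcon z hz hzi, ?_⟩
        rw [flipAt_same]
        revert hzi
        cases z i <;> cases s i <;> simp)
    exact hsi (Finset.mem_filter.1 (key s (Finset.mem_filter.2 ⟨hs, rfl⟩))).1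
  obtain ⟨u, hu, hui, huf⟩ := hex
  have : u = σ s := by
    by_contra hne
    exact huf (h.flip_or i s hs u hu (hi s hs) (hi u hu) hui.symm hne hsi)
  exact this ▸ huf

/-- A direction crossed by all pairs has at most one exceptional pair: `flip_or` excludes a second
one directly if `t` is opposite `s`, and through `σ t` otherwise. -/
theorem eq_or_eq_partner (h : IsObstruction X σ) {i : Fin d}
    (hi : ∀ x ∈ X, σ x i ≠ x i) {s t : Fin d → Bool} (hs : s ∈ X) (hsi : flipAt s i ∉ X)
    (ht : t ∈ X) (hti : flipAt t i ∉ X) : t = s ∨ t = σ s := by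
  by_contra hcon
  push Not at hcon
  have aux : ∀ u ∈ X, flipAt u i ∉ X → s i ≠ u i → u = σ s := by
    intro u hu hui hsu
    by_contra hne
    exact hui (h.flip_or i s hs u hu (hi s hs) (hi u hu) hsu hne hsi)
  by_cases hst : s i = t i
  · have h1 := aux (σ t) (h.mem t ht) (h.flip_partner_not_mem hi ht hti)
      (by rw [hst]; exact (hi t ht).symm)
    exact hcon.1 (h.injOn ht hs h1)
  · exact hcon.2 (aux t ht hti hst)

/-- If the flip of `s ∈ X` in direction `i` is outside `X`, then in every other direction in which
some pair does not cross, `s` lies on the side of that pair. -/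
theorem eq_majority (h : IsObstruction X σ) {i j : Fin d} (hi : ∀ x ∈ X, σ x i ≠ x i)
    {s x : Fin d → Bool} (hs : s ∈ X) (hsi : flipAt s i ∉ X) (hx : x ∈ X) (hxj : σ x j = x j) :
    s j = x j := by
  by_contra hsj
  have hij : i ≠ j := by rintro rfl; exact hi x hx hxj
  have hsc : σ s j ≠ s j := fun e => hsj (h.same_side j s hs x hx e hxj)
  have htX := h.mem s hs
  have hti := h.flip_partner_not_mem hi hs hsi
  -- This vertex lies outside the only pair exceptional for `i`, so it can be flipped in direction
  -- `i`, and then back in direction `j`. The result is the flip of `σ s` in direction `i`, which is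
  -- not in `X`.
  have hu : flipAt (σ s) j ∈ X :=
    h.flip_mem_of_crossing hx hxj htX (by rw [h.invol s hs]; exact hsc.symm)
  have hui : flipAt (flipAt (σ s) j) i ∈ X := by
    by_contra hcon
    rcases h.eq_or_eq_partner hi hs hsi hu hcon with e | e
    · have := congrFun e i
      rw [flipAt_of_ne _ hij] at this
      exact hi s hs this
    · exact flipAt_ne _ _ e
  have hv := h.flip_mem_of_ne hx hxj hui (by
    rw [flipAt_of_ne _ hij.symm, flipAt_same]
    revert hsj hsc
    cases s j <;> cases x j <;> cases σ s j <;> simp)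
  rw [flipAt_comm _ j i, flipAt_flipAt] at hv
  exact hti hv

theorem crossing_of_exceptional (h : IsObstruction X σ) {i : Fin d} {s : Fin d → Bool}
    (hs : s ∈ X) (hsc : σ s i ≠ s i) (hsi : flipAt s i ∉ X) : ∀ x ∈ X, σ x i ≠ x i :=
  fun _ hx hxi => hsi (h.flip_mem_of_crossing hx hxi hs hsc)

/-- If some flip of a crossing vertex leaves `X`, then all pairs are antipodal. -/
theorem antipodal_of_exceptional (h : IsObstruction X σ) {i : Fin d} {s : Fin d → Bool}
    (hs : s ∈ X) (hsc : σ s i ≠ s i) (hsi : flipAt s i ∉ X) (j : Fin d) :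
    ∀ x ∈ X, σ x j ≠ x j := by
  intro x hx hxj
  have hi := h.crossing_of_exceptional hs hsc hsi
  have hij : i ≠ j := by rintro rfl; exact hi x hx hxj
  have hsj := h.eq_majority hi hs hsi hx hxj
  have hwj : flipAt (flipAt s i) j j = !x j := by
    rw [flipAt_same, flipAt_of_ne _ hij.symm, hsj]
  -- The walk towards this vertex stays in `X` opposite `x`. In a direction `k` with a noncrossing
  -- pair, the target agrees with that pair, so `flip_mem_of_ne` applies; in a direction crossed by
  -- all pairs, a flip leaving `X` would put `y` on the side of `x`. A final flip in direction `j`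
  -- reaches the excluded `flipAt s i`.
  have hw : flipAt (flipAt s i) j ∈ X.filter (fun z => z j ≠ x j) := by
    refine mem_of_flipAt_closed ?_ ?_
    · obtain ⟨y, hy, hyj⟩ := h.sep j (!x j)
      exact ⟨y, Finset.mem_filter.2 ⟨hy, by rw [hyj]; simp⟩⟩
    · intro y hy k hk
      obtain ⟨hy, hyj⟩ := Finset.mem_filter.1 hy
      have hkj : k ≠ j := by
        rintro rfl
        rw [hwj] at hk
        revert hk hyj
        cases y k <;> cases x k <;> simp
      refine Finset.mem_filter.2 ⟨?_, by rwa [flipAt_of_ne _ hkj.symm]⟩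
      by_cases hB : ∃ z ∈ X, σ z k = z k
      · obtain ⟨z, hz, hzk⟩ := hB
        have hki : k ≠ i := by rintro rfl; exact hi z hz hzk
        refine h.flip_mem_of_ne hz hzk hy ?_
        rwa [flipAt_of_ne _ hkj, flipAt_of_ne _ hki, h.eq_majority hi hs hsi hz hzk] at hk
      · push Not at hB
        by_contra hcon
        exact hyj (h.eq_majority hB hy hcon hx hxj)
  obtain ⟨hwX, hwne⟩ := Finset.mem_filter.1 hw
  have := h.flip_mem_of_ne hx hxj hwX hwne
  rw [flipAt_flipAt] at this
  exact hsi this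

/-- Otherwise all pairs are antipodal, and a vertex together with its neighbours in `X` is disjoint
from the set of their partners; hence it has at most `(d - 1) / 2` neighbours in `X`. Each direction
is exceptional for at most one pair, so the neighbour directions of `s` and of a vertex `y` of
another pair cover all `d` directions, which is too many. -/
theorem flip_mem_of_crossing_all (h : IsObstruction X σ) (hd : 3 ≤ d) (i : Fin d)
    {s : Fin d → Bool} (hs : s ∈ X) (hsc : σ s i ≠ s i) : flipAt s i ∈ X := by
  classical
  by_contra hsi
  have hall := h.antipodal_of_exceptional hs hsc hsi
  have count : ∀ x ∈ X, 2 * ((Finset.univ.filter (fun j => flipAt x j ∈ X)).card + 1) ≤ d + 1 := by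
    intro x hx
    set N := Finset.univ.filter (fun j => flipAt x j ∈ X) with hN
    set T := insert x (N.image (fun j => flipAt x j)) with hT
    have hTX : ∀ u ∈ T, u ∈ X := by
      intro u hu
      rcases Finset.mem_insert.1 hu with rfl | hu
      · exact hx
      · obtain ⟨j, hj, rfl⟩ := Finset.mem_image.1 hu
        exact (Finset.mem_filter.1 hj).2
    have hTe : ∀ u ∈ T, ∃ j, ∀ k, k ≠ j → u k = x k := by
      intro u hu
      rcases Finset.mem_insert.1 hu with rfl | hu
      · exact ⟨i, fun _ _ => rfl⟩
      · obtain ⟨j, hj, rfl⟩ := Finset.mem_image.1 hu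
        exact ⟨j, fun k hk => flipAt_of_ne _ hk⟩
    have hTc : T.card = N.card + 1 := by
      rw [hT, Finset.card_insert_of_notMem, Finset.card_image_of_injective]
      · exact flipAt_right_injective _
      · intro hmem
        obtain ⟨j, -, hj⟩ := Finset.mem_image.1 hmem
        exact flipAt_ne _ _ hj
    -- Two vertices of `T` each differ from `x` in at most one coordinate, so they agree in a third
    -- one and are not antipodal.
    have hdis : Disjoint T (T.image σ) := by
      rw [Finset.disjoint_left]
      intro u hu hu'
      obtain ⟨v, hv, rfl⟩ := Finset.mem_image.1 hu'
      obtain ⟨j, hj⟩ := hTe _ hu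
      obtain ⟨k, hk⟩ := hTe _ hv
      obtain ⟨m, hm⟩ : ∃ m, m ∉ ({j, k} : Finset (Fin d)) := by
        by_contra hcon
        push Not at hcon
        have h1 : (Finset.univ : Finset (Fin d)) ⊆ {j, k} := fun m _ => hcon m
        have h2 := (Finset.card_le_card h1).trans Finset.card_le_two
        rw [Finset.card_univ, Fintype.card_fin] at h2
        omega
      simp only [Finset.mem_insert, Finset.mem_singleton, not_or] at hm
      exact hall m v (hTX v hv) ((hj m hm.1).trans (hk m hm.2).symm)
    have hsub : T ∪ T.image σ ⊆ X := by
      intro u hu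
      rcases Finset.mem_union.1 hu with hu | hu
      · exact hTX u hu
      · obtain ⟨v, hv, rfl⟩ := Finset.mem_image.1 hu
        exact h.mem v (hTX v hv)
    have h1 := Finset.card_le_card hsub
    rw [Finset.card_union_of_disjoint hdis, Finset.card_image_of_injOn
      (h.injOn.mono (fun u hu => hTX u hu)), hTc, h.card] at h1
    omega
  obtain ⟨y, hy, hys⟩ : ∃ y ∈ X, y ∉ ({s, σ s} : Finset (Fin d → Bool)) := by
    by_contra hcon
    push Not at hcon
    have h2 := (Finset.card_le_card hcon).trans Finset.card_le_two
    rw [h.card] at h2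
    omega
  simp only [Finset.mem_insert, Finset.mem_singleton] at hys
  have hcov : (Finset.univ : Finset (Fin d)) ⊆ Finset.univ.filter (fun j => flipAt s j ∈ X) ∪
      Finset.univ.filter (fun j => flipAt y j ∈ X) := by
    intro j _
    by_contra hcon
    simp only [Finset.mem_union, Finset.mem_filter, Finset.mem_univ, true_and, not_or] at hcon
    exact hys (h.eq_or_eq_partner (hall j) hs hcon.1 hy hcon.2)
  have h1 := (Finset.card_le_card hcov).trans (Finset.card_union_le _ _)
  rw [Finset.card_univ, Fintype.card_fin] at h1
  have h2 := count s hs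
  have h3 := count y hy
  omega

/-- Let `w` collect, for each direction, a side opposite which every vertex crosses. Moving towards
`w` stays in `X`, so `X` contains `w` and all its neighbours, and by cardinality nothing else. Then
`flipAt w i₀` is alone on its side; its partner crosses and flips into `X`, hence onto it,
contradicting `flip_ne`. -/
theorem elim (h : IsObstruction X σ) (hd : 3 ≤ d) : False := by
  classical
  have hflip : ∀ i, ∀ x ∈ X, σ x i ≠ x i → flipAt x i ∈ X :=
    fun i x hx hxi => h.flip_mem_of_crossing_all hd i hx hxi
  have hw : ∀ i, ∃ b, ∀ x ∈ X, x i ≠ b → σ x i ≠ x i := by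
    intro i
    by_cases hB : ∃ z ∈ X, σ z i = z i
    · obtain ⟨z, hz, hzi⟩ := hB
      exact ⟨z i, fun x hx hxi e => hxi (h.same_side i x hx z hz e hzi)⟩
    · push Not at hB
      exact ⟨true, fun x hx _ => hB x hx⟩
  choose w hw using hw
  have hmove : ∀ i, ∀ x ∈ X, x i ≠ w i → flipAt x i ∈ X :=
    fun i x hx hxi => hflip i x hx (hw i x hx hxi)
  let i₀ : Fin d := ⟨0, by omega⟩
  have hwX : w ∈ X := by
    obtain ⟨x, hx, -⟩ := h.sep i₀ true
    exact mem_of_flipAt_closed ⟨x, hx⟩ (fun x hx j hj => hmove j x hx hj)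
  have hwf : ∀ i, flipAt w i ∈ X := by
    intro i
    refine (Finset.mem_filter.1 (mem_of_flipAt_closed (M := X.filter (fun x => x i = !w i))
      (w := flipAt w i) ?_ ?_)).1
    · obtain ⟨x, hx, hxi⟩ := h.sep i (!w i)
      exact ⟨x, Finset.mem_filter.2 ⟨hx, hxi⟩⟩
    · intro x hx j hj
      obtain ⟨hx, hxi⟩ := Finset.mem_filter.1 hx
      have hji : j ≠ i := by rintro rfl; rw [flipAt_same] at hj; exact hj hxi
      rw [flipAt_of_ne _ hji] at hj
      exact Finset.mem_filter.2 ⟨hmove j x hx hj, by rwa [flipAt_of_ne _ hji.symm]⟩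
  have hXeq : insert w (Finset.univ.image (fun i => flipAt w i)) = X := by
    refine Finset.eq_of_subset_of_card_le ?_ ?_
    · intro u hu
      rcases Finset.mem_insert.1 hu with rfl | hu
      · exact hwX
      · obtain ⟨j, -, rfl⟩ := Finset.mem_image.1 hu
        exact hwf j
    · rw [h.card, Finset.card_insert_of_notMem, Finset.card_image_of_injective]
      · simp
      · exact flipAt_right_injective _
      · intro hmem
        obtain ⟨j, -, hj⟩ := Finset.mem_image.1 hmem
        exact flipAt_ne _ _ hj
  have huniq : ∀ u ∈ X, u i₀ ≠ w i₀ → u = flipAt w i₀ := by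
    intro u hu hui
    rw [← hXeq] at hu
    rcases Finset.mem_insert.1 hu with rfl | hu
    · exact absurd rfl hui
    · obtain ⟨j, -, rfl⟩ := Finset.mem_image.1 hu
      by_cases hj : i₀ = j
      · rw [hj]
      · exact absurd (flipAt_of_ne _ hj) hui
  have hx := hwf i₀
  have hxi : flipAt w i₀ i₀ ≠ w i₀ := by simp
  have hxc := hw i₀ _ hx hxi
  have hyc : σ (σ (flipAt w i₀)) i₀ ≠ σ (flipAt w i₀) i₀ := by
    rw [h.invol _ hx]; exact hxc.symm
  have hyf := hflip i₀ _ (h.mem _ hx) hyc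
  have := huniq _ hyf (by
    rw [flipAt_same]
    rw [flipAt_same] at hxc
    revert hxc
    cases σ (flipAt w i₀) i₀ <;> cases w i₀ <;> simp)
  exact h.flip_ne i₀ _ (h.mem _ hx) hyc (by rw [this, h.invol _ hx])

end IsObstruction

/-! ### The induction step -/

theorem CubeLinked.succ {d : ℕ} (hd : CubeLinked d) (hd4 : 4 ≤ d) : CubeLinked (d + 1) := by
  classical
  intro X l hX hl
  obtain ⟨σ, hσ⟩ := hl.exists_isPartner
  by_contra hN
  have key := fun i R h1 h2 h3 => hN (hd.linkable_of_released hd4 hσ hX i R h1 h2 h3)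
  have hcard : d + 2 ≤ X.card := by
    by_contra hc
    exact key 0 ∅ (by simp) (by simp) (fun b => Or.inl (by omega))
  have hne : ∀ {a b c : Bool}, a ≠ b → c ≠ b → c = a := by decide
  refine IsObstruction.elim (X := X) (σ := σ) ⟨by omega, hσ.mem, hσ.invol, ?_, ?_, ?_, ?_, ?_⟩
    (by omega)
  · intro i b
    by_contra hcon
    push Not at hcon
    exact hN (hd.linkable_of_facet (by omega) hσ hX i (!b) (fun x hx => by
      have := hcon x hx
      revert this
      cases x i <;> cases b <;> simp))
  · intro i x hx y hy hxi hyi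
    by_contra hxy
    -- Noncrossing vertices on both sides already save a terminal in both facets.
    refine key i ∅ (by simp) (by simp) (fun b => Or.inr ?_)
    by_cases hb : x i = b
    · exact ⟨y, hy, fun e => hxy (hb.trans e.symm), Or.inl hyi⟩
    · exact ⟨x, hx, hb, Or.inl hxi⟩
  · intro i x hx s hs hxi hsi hsx
    by_contra hf
    -- Releasing `s` saves a terminal on its own side, and `x` saves one on the other side.
    refine key i {s} (by simp [hf]) (fun a ha ha' => ?_) (fun b => Or.inr ?_)
    · rw [Finset.mem_singleton] at ha ha'
      rw [ha] at ha'
      rw [ha'] at hsi; exact absurd rfl hsi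
    · by_cases hb : x i = b
      · exact ⟨σ s, hσ.mem s hs, by rw [← hb, ← hsx]; exact hsi,
          Or.inr (Or.inl (by simp [hσ.invol s hs]))⟩
      · exact ⟨x, hx, hb, Or.inl hxi⟩
  · intro i s hs hsi hf
    -- The pair is itself an edge in direction `i`, so neither end creates a new terminal.
    refine key i {s} (by simp [hf]) (by simp [hf]) (fun b => Or.inr ?_)
    by_cases hb : s i = b
    · exact ⟨σ s, hσ.mem s hs, by rw [← hb]; exact hsi,
        Or.inr (Or.inl (by simp [hσ.invol s hs]))⟩
    · exact ⟨s, hs, hb, Or.inr (Or.inr ⟨by simp, hf⟩)⟩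
  · intro i s hs t ht hsi hti hst hts hsf
    by_contra htf
    have hs' : s ≠ σ s := fun e => hsi (by rw [← e])
    have ht' : t ≠ σ t := fun e => hti (by rw [← e])
    have hst' : s ≠ σ t := fun e => hts (by rw [e, hσ.invol t ht])
    -- `s` and `t` are released from opposite sides, each saving a terminal on its own side.
    refine key i {s, t} ?_ ?_ (fun b => Or.inr ?_)
    · intro a ha
      simp only [Finset.mem_insert, Finset.mem_singleton] at ha
      rcases ha with rfl | rfl
      · exact fun h => absurd h hsf
      · exact fun h => absurd h htf
    · intro a ha ha'
      simp only [Finset.mem_insert, Finset.mem_singleton] at ha ha'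
      rcases ha with rfl | rfl
      · rcases ha' with h | h
        · exact absurd h.symm hs'
        · exact absurd h.symm hts
      · rcases ha' with h | h
        · exact absurd h.symm hst'
        · exact absurd h.symm ht'
    · by_cases hb : s i = b
      · exact ⟨σ s, hσ.mem s hs, by rw [← hb]; exact hsi,
          Or.inr (Or.inl (by simp [hσ.invol s hs]))⟩
      · refine ⟨σ t, hσ.mem t ht, ?_, Or.inr (Or.inl (by simp [hσ.invol t ht]))⟩
        intro e
        exact hti (e.trans (hne hst.symm (fun e => hb e.symm)))

/-! ### Small cubes -/

/-- The position of a vertex of the 4-cube in a bit mask. -/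
def maskIdx (x : Fin 4 → Bool) : ℕ :=
  (x 0).toNat + 2 * (x 1).toNat + 4 * (x 2).toNat + 8 * (x 3).toNat

/-- The vertices of the 4-cube adjacent to a vertex of the mask `s`. -/
def maskNbr (s : ℕ) : ℕ :=
  ((s &&& 21845) <<< 1) ||| ((s &&& 43690) >>> 1) ||| ((s &&& 13107) <<< 2) |||
  ((s &&& 52428) >>> 2) ||| ((s &&& 3855) <<< 4) ||| ((s &&& 61680) >>> 4) |||
  ((s &&& 255) <<< 8) ||| ((s &&& 65280) >>> 8)

/-- The vertices of `A` at distance at most `n` from `s` inside `A`. -/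
def maskGrow (A : ℕ) : ℕ → ℕ → ℕ
  | 0, s => s
  | n + 1, s => maskGrow A n (s ||| (maskNbr s &&& A))

/-- A test for connectedness of the set of vertices with mask `A`. -/
def maskConn (A : ℕ) : Bool :=
  (List.range 16).any fun v => A.testBit v && (maskGrow A 8 (1 <<< v) == A)

/-- Masks `A` of connected sets of vertices of the 4-cube containing the origin, each with the mask
of those vertices `x` for which the complement of `A ∪ {x}` is connected. -/
def maskTable : List (ℕ × ℕ) :=
  [
   (15, 65520), (113, 65422), (1793, 63742), (28689, 36846), (32931, 32604), (19461, 46074),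
   (45313, 20222), (10755, 54780), (197, 65338), (34845, 30690), (20747, 44788), (3465, 62006),
   (8993, 56534), (50257, 15270), (4281, 60742), (16967, 48568), (5141, 59882), (35713, 29822),
   (9255, 56280), (20801, 44702), (51211, 14324), (8881, 56646), (20557, 44946), (41101, 24434),
   (3619, 57820), (339, 65196), (43057, 22478), (2637, 62866), (203, 64308), (12451, 53020),
   (16613, 44826), (17665, 47870), (7433, 58038), (2187, 63348), (35335, 30072), (12803, 51708),
   (3589, 57850), (16453, 49082)]

theorem maskTable_conn : (maskTable.all fun p => p.1.testBit 0 && maskConn p.1 &&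
    (List.range 16).all fun x => !p.2.testBit x ||
      (!p.1.testBit x && maskConn (65535 ^^^ p.1 ^^^ (1 <<< x)))) = true := by
  decide +kernel

/-- The vertices of `m` in every `A` of the list that admits `x`, contains `t` and avoids `a`. -/
def maskCommon (t x a m : ℕ) : List (ℕ × ℕ) → ℕ
  | [] => m
  | p :: L => bif p.2.testBit x && (p.1.testBit t && !p.1.testBit a) then
      p.1 &&& maskCommon t x a m L else maskCommon t x a m L

/-- The origin is to be joined to `t`, the vertex `x` is forbidden, and `a` belongs to the second
pair. An empty common part means that every remaining vertex `b` is missed by some admissible `A`,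
so no loop over `b` is needed. -/
theorem maskTable_complete : ((List.range 16).all fun t => (List.range 16).all fun x =>
    (List.range 16).all fun a => t == 0 || (x == 0 || (a == 0 || (t == x || (t == a || (x == a ||
      maskCommon t x a (65535 ^^^ (1 ||| 1 <<< t ||| 1 <<< x ||| 1 <<< a)) maskTable == 0))))))
      = true := by
  decide +kernel

theorem maskIdx_lt (x : Fin 4 → Bool) : maskIdx x < 16 := by
  revert x; decide

theorem maskIdx_injective : Function.Injective maskIdx := by
  unfold Function.Injective; decide

theorem maskIdx_surj : ∀ v ∈ List.range 16, ∃ x, maskIdx x = v := by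
  decide

/-! ### From masks to connected sets of vertices -/

theorem testBit_maskNbr (s : ℕ) (x : Fin 4 → Bool) (h : (maskNbr s).testBit (maskIdx x) = true) :
    ∃ i, s.testBit (maskIdx (flipAt x i)) = true := by
  have hx : x = ![x 0, x 1, x 2, x 3] := by ext i; fin_cases i <;> rfl
  have key : s.testBit (maskIdx (flipAt x 0)) = true ∨ s.testBit (maskIdx (flipAt x 1)) = true ∨
      s.testBit (maskIdx (flipAt x 2)) = true ∨ s.testBit (maskIdx (flipAt x 3)) = true := by
    rw [hx] at h ⊢
    revert h
    generalize x 0 = a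
    generalize x 1 = b
    generalize x 2 = c
    generalize x 3 = e
    cases a <;> cases b <;> cases c <;> cases e <;>
      simp [maskNbr, maskIdx, flipAt, Nat.testBit_or, Nat.testBit_and, Nat.testBit_shiftLeft,
        Nat.testBit_shiftRight, Function.update] <;> grind
  rcases key with h | h | h | h <;> exact ⟨_, h⟩

/-- The set of vertices with mask `A`. -/
def maskSet (A : ℕ) : Set (Fin 4 → Bool) := {x | A.testBit (maskIdx x) = true}

/-- Connectedness of a set of vertices of the cube. -/
def IsConnSet {d : ℕ} (A : Set (Fin d → Bool)) : Prop :=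
  ∀ x ∈ A, ∀ y ∈ A, (monoOn (cubeGraph d) (fun _ => 0) A).Reachable x y

/-- Only soundness of the growth is needed: whatever it reaches is connected to `v` inside `A`. -/
theorem reachable_of_testBit_maskGrow {A : ℕ} {v : Fin 4 → Bool} (n s : ℕ)
    (hs : ∀ x, s.testBit (maskIdx x) = true → x ∈ maskSet A ∧
      (monoOn (cubeGraph 4) (fun _ => 0) (maskSet A)).Reachable v x) (x : Fin 4 → Bool)
    (hx : (maskGrow A n s).testBit (maskIdx x) = true) :
    (monoOn (cubeGraph 4) (fun _ => 0) (maskSet A)).Reachable v x := by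
  induction n generalizing s with
  | zero => exact (hs x hx).2
  | succ n ih =>
    refine ih _ (fun y hy => ?_) hx
    rw [Nat.testBit_or, Bool.or_eq_true, Nat.testBit_and, Bool.and_eq_true] at hy
    rcases hy with hy | ⟨h1, h2⟩
    · exact hs y hy
    · obtain ⟨i, hi⟩ := testBit_maskNbr s y h1
      obtain ⟨h3, h4⟩ := hs _ hi
      exact ⟨h2, h4.trans (SimpleGraph.Adj.reachable
        ⟨(cubeGraph_adj_flipAt y i).symm, rfl, h3, h2⟩)⟩

theorem isConnSet_of_maskConn {A : ℕ} (h : maskConn A = true) : IsConnSet (maskSet A) := by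
  obtain ⟨k, hk, hkA⟩ := List.any_eq_true.1 h
  obtain ⟨v, rfl⟩ := maskIdx_surj k hk
  rw [Bool.and_eq_true, beq_iff_eq] at hkA
  have key : ∀ x ∈ maskSet A, (monoOn (cubeGraph 4) (fun _ => 0) (maskSet A)).Reachable v x := by
    intro x hx
    refine reachable_of_testBit_maskGrow 8 (1 <<< maskIdx v) (fun y hy => ?_) x
      (by rw [hkA.2]; exact hx)
    have : y = v := by
      apply maskIdx_injective
      rw [Nat.one_shiftLeft, Nat.testBit_two_pow] at hy
      simpa [eq_comm] using hy
    subst this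
    exact ⟨hkA.1, SimpleGraph.Reachable.refl _⟩
  exact fun x hx y hy => (key x hx).symm.trans (key y hy)

theorem exists_of_maskCommon {t x a m b : ℕ} {L : List (ℕ × ℕ)}
    (h : (maskCommon t x a m L).testBit b = false) (hm : m.testBit b = true) :
    ∃ p ∈ L, p.2.testBit x = true ∧ p.1.testBit t = true ∧ p.1.testBit a = false ∧
      p.1.testBit b = false := by
  induction L with
  | nil => rw [maskCommon, hm] at h; exact absurd h (by simp)
  | cons p L ih =>
    have tail : (maskCommon t x a m L).testBit b = false → ∃ r ∈ p :: L, r.2.testBit x = true ∧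
        r.1.testBit t = true ∧ r.1.testBit a = false ∧ r.1.testBit b = false := fun h => by
      obtain ⟨r, hr, h'⟩ := ih h
      exact ⟨r, List.mem_cons_of_mem _ hr, h'⟩
    rw [maskCommon] at h
    cases hc : (p.2.testBit x && (p.1.testBit t && !p.1.testBit a)) with
    | false => rw [hc] at h; exact tail h
    | true =>
      rw [hc, cond_true, Nat.testBit_and, Bool.and_eq_false_iff] at h
      rcases h with h | h
      · simp only [Bool.and_eq_true, Bool.not_eq_true'] at hc
        exact ⟨p, List.mem_cons_self, hc.1, hc.2.1, hc.2.2, h⟩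
      · exact tail h

theorem exists_connSets_origin (t x a b : Fin 4 → Bool) (o : Fin 4 → Bool)
    (ho : o = fun _ => false) (hto : t ≠ o) (hxo : x ≠ o) (hao : a ≠ o) (hbo : b ≠ o) (htx : t ≠ x)
    (hta : t ≠ a) (htb : t ≠ b) (hxa : x ≠ a) (hxb : x ≠ b) (hab : a ≠ b) :
    ∃ A B : Set (Fin 4 → Bool), Disjoint A B ∧ x ∉ A ∧ x ∉ B ∧ o ∈ A ∧ t ∈ A ∧ a ∈ B ∧ b ∈ B ∧
      IsConnSet A ∧ IsConnSet B := by
  have ho' : maskIdx o = 0 := by rw [ho]; rfl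
  have hr : ∀ y : Fin 4 → Bool, maskIdx y ∈ List.range 16 := fun y =>
    List.mem_range.2 (maskIdx_lt y)
  have hz : ∀ y : Fin 4 → Bool, y ≠ o → maskIdx y ≠ 0 := fun y hy e =>
    hy (maskIdx_injective (e.trans ho'.symm))
  have hne : ∀ y z : Fin 4 → Bool, y ≠ z → maskIdx y ≠ maskIdx z := fun y z h e =>
    h (maskIdx_injective e)
  have full : ∀ y : Fin 4 → Bool, Nat.testBit 65535 (maskIdx y) = true := by decide
  have h1 := List.all_eq_true.1 (List.all_eq_true.1 (List.all_eq_true.1 maskTable_complete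
    _ (hr t)) _ (hr x)) _ (hr a)
  simp only [Bool.or_eq_true, beq_iff_eq, hz t hto, hz x hxo, hz a hao, hne t x htx, hne t a hta,
    hne x a hxa, false_or] at h1
  obtain ⟨p, hp, hpx, hpt, hpa, hpb⟩ := exists_of_maskCommon (b := maskIdx b)
    (by rw [h1]; simp) (by
      have h0 : Nat.testBit 1 (maskIdx b) = false := by
        rw [← pow_zero 2, Nat.testBit_two_pow]
        simpa using (hz b hbo).symm
      simp [Nat.testBit_xor, Nat.testBit_or, full b, Nat.one_shiftLeft,
        hne t b htb, hne x b hxb, hne a b hab, h0])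
  have h2 := List.all_eq_true.1 maskTable_conn p hp
  rw [Bool.and_eq_true, Bool.and_eq_true] at h2
  have h3 := List.all_eq_true.1 h2.2 _ (hr x)
  rw [hpx] at h3
  simp only [Bool.not_true, Bool.false_or, Bool.and_eq_true, Bool.not_eq_true'] at h3
  -- Since `x` is outside `A`, toggling its bit in the complement of `A` removes it; the second
  -- alternative is vacuous.
  have hB : ∀ y, y ∈ maskSet (65535 ^^^ p.1 ^^^ 1 <<< maskIdx x) ↔ (y ∉ maskSet p.1 ∧ y ≠ x) ∨
      (y ∈ maskSet p.1 ∧ y = x) := by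
    intro y
    have : maskIdx x = maskIdx y ↔ y = x := ⟨fun e => maskIdx_injective e.symm, fun e => by rw [e]⟩
    simp only [maskSet, Set.mem_ofPred_eq, Nat.testBit_xor, full y, Nat.one_shiftLeft,
      Nat.testBit_two_pow, this]
    by_cases hy : y = x <;> cases p.1.testBit (maskIdx y) <;> simp [hy]
  have hxA : x ∉ maskSet p.1 := by simp [maskSet, h3.1]
  refine ⟨maskSet p.1, maskSet (65535 ^^^ p.1 ^^^ 1 <<< maskIdx x), ?_, hxA, ?_, ?_, hpt, ?_, ?_,
    isConnSet_of_maskConn h2.1.2, isConnSet_of_maskConn h3.2⟩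
  · rw [Set.disjoint_left]
    intro y hy hy'
    rcases (hB y).1 hy' with h | h
    · exact h.1 hy
    · exact hxA (h.2 ▸ hy)
  · rw [hB]; simp [hxA]
  · change p.1.testBit (maskIdx o) = true
    rw [ho']; exact h2.1.1
  · rw [hB]; exact Or.inl ⟨by simp [maskSet, hpa], hxa.symm⟩
  · rw [hB]; exact Or.inl ⟨by simp [maskSet, hpb], hxb.symm⟩

/-- Translation in the cube. -/
def cubeTranslate {d : ℕ} (s x : Fin d → Bool) : Fin d → Bool := fun i => xor (s i) (x i)

theorem cubeTranslate_cubeTranslate {d : ℕ} (s x : Fin d → Bool) :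
    cubeTranslate s (cubeTranslate s x) = x := by
  ext i; simp [cubeTranslate]

theorem cubeTranslate_flipAt {d : ℕ} (s x : Fin d → Bool) (i : Fin d) :
    cubeTranslate s (flipAt x i) = flipAt (cubeTranslate s x) i := by
  ext j
  by_cases h : j = i
  · subst h; simp [cubeTranslate]
  · simp [cubeTranslate, flipAt_of_ne _ h]

theorem IsConnSet.preimage {d : ℕ} {A : Set (Fin d → Bool)} (h : IsConnSet A) (s : Fin d → Bool) :
    IsConnSet (cubeTranslate s ⁻¹' A) := by
  intro x hx y hy
  let f : monoOn (cubeGraph d) (fun _ => 0) A →g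
      monoOn (cubeGraph d) (fun _ => 0) (cubeTranslate s ⁻¹' A) :=
    { toFun := cubeTranslate s
      map_rel' := by
        rintro u v ⟨⟨j, rfl⟩, -, h2, h3⟩
        refine ⟨⟨j, cubeTranslate_flipAt s u j⟩, rfl, ?_, ?_⟩ <;>
          simpa [cubeTranslate_cubeTranslate] }
  have := (h _ hx _ hy).map f
  change (monoOn _ _ _).Reachable (cubeTranslate s (cubeTranslate s x))
    (cubeTranslate s (cubeTranslate s y)) at this
  rwa [cubeTranslate_cubeTranslate, cubeTranslate_cubeTranslate] at this

/-- In the 4-cube, two disjoint pairs can be joined avoiding a fifth vertex. -/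
theorem exists_connSets (s t x a b : Fin 4 → Bool) (hts : t ≠ s) (hxs : x ≠ s) (has : a ≠ s)
    (hbs : b ≠ s) (htx : t ≠ x) (hta : t ≠ a) (htb : t ≠ b) (hxa : x ≠ a) (hxb : x ≠ b)
    (hab : a ≠ b) :
    ∃ A B : Set (Fin 4 → Bool), Disjoint A B ∧ x ∉ A ∧ x ∉ B ∧ s ∈ A ∧ t ∈ A ∧ a ∈ B ∧ b ∈ B ∧
      IsConnSet A ∧ IsConnSet B := by
  have inj : ∀ {u v : Fin 4 → Bool}, u ≠ v → cubeTranslate s u ≠ cubeTranslate s v := by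
    intro u v h e
    exact h (by rw [← cubeTranslate_cubeTranslate s u, e, cubeTranslate_cubeTranslate])
  obtain ⟨A, B, h⟩ := exists_connSets_origin (cubeTranslate s t) (cubeTranslate s x)
    (cubeTranslate s a) (cubeTranslate s b) (cubeTranslate s s) (by ext i; simp [cubeTranslate])
    (inj hts) (inj hxs) (inj has) (inj hbs) (inj htx) (inj hta) (inj htb) (inj hxa) (inj hxb)
    (inj hab)
  exact ⟨cubeTranslate s ⁻¹' A, cubeTranslate s ⁻¹' B, h.1.preimage _, h.2.1, h.2.2.1, h.2.2.2.1,
    h.2.2.2.2.1, h.2.2.2.2.2.1, h.2.2.2.2.2.2.1, h.2.2.2.2.2.2.2.1.preimage s,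
    h.2.2.2.2.2.2.2.2.preimage s⟩

theorem IsConnSet.reachable {d : ℕ} {A : Set (Fin d → Bool)} (h : IsConnSet A)
    {c : (Fin d → Bool) → ℕ} {k : ℕ} (hc : ∀ u ∈ A, c u = k) {x y : Fin d → Bool} (hx : x ∈ A)
    (hy : y ∈ A) : (monoOn (cubeGraph d) c Set.univ).Reachable x y := by
  refine (h x hx y hy).mono ?_
  intro u v huv
  exact ⟨huv.1, by rw [hc u huv.2.2.1, hc v huv.2.2.2], trivial, trivial⟩

/-! ### Linkages in dimensions 0, 1, 2 and 4 -/

theorem linkable_of_injOn {V : Type*} {G : SimpleGraph V} {A : Set V} {Y : Finset V} {l : V → ℕ}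
    (h : ∀ x ∈ Y, ∀ y ∈ Y, l x = l y → x = y) : Linkable G A Y l :=
  ⟨l, fun _ _ => rfl, fun x hx y hy hxy => by rw [h x hx y hy hxy]⟩

theorem cubeLinked_zero : CubeLinked 0 := by
  intro Y l hY _
  exact linkable_of_injOn (fun x _ y _ _ => Subsingleton.elim x y)

theorem cubeLinked_one : CubeLinked 1 := by
  intro Y l _ _
  refine ⟨l, fun _ _ => rfl, fun x _ y _ hxy => ?_⟩
  have : ∀ x y : Fin 1 → Bool, x = y ∨ y = flipAt x 0 := by decide
  rcases this x y with h | h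
  · rw [h]
  · exact SimpleGraph.Adj.reachable ⟨⟨0, h⟩, hxy, trivial, trivial⟩

/-- Three terminals contain at most one pair. Opposite corners of a square have two common
neighbours, one of which is not the third terminal. -/
theorem cubeLinked_two : CubeLinked 2 := by
  classical
  intro Y l hY hl
  by_cases hinj : ∀ x ∈ Y, ∀ y ∈ Y, l x = l y → x = y
  · exact linkable_of_injOn hinj
  push Not at hinj
  obtain ⟨x, hx, y, hy, hxy, hne⟩ := hinj
  have hcard : ((Y.erase x).erase y).card ≤ 1 := by
    rw [Finset.card_erase_of_mem (Finset.mem_erase.2 ⟨hne.symm, hy⟩), Finset.card_erase_of_mem hx]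
    omega
  obtain ⟨z, hz⟩ : ∃ z, ∀ u ∈ Y, u = x ∨ u = y ∨ u = z := by
    by_cases he : ((Y.erase x).erase y).Nonempty
    · obtain ⟨z, hz⟩ := he
      refine ⟨z, fun u hu => ?_⟩
      by_contra hcon
      push Not at hcon
      exact hcon.2.2 (Finset.card_le_one.1 hcard u (by simp [hcon.1, hcon.2.1, hu]) z hz)
    · refine ⟨x, fun u hu => ?_⟩
      by_contra hcon
      push Not at hcon
      exact he ⟨u, by simp [hcon.1, hcon.2.1, hu]⟩
  have hpath : ∀ x y z : Fin 2 → Bool, (∃ i, y = flipAt x i) ∨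
      ∃ i j, y = flipAt (flipAt x i) j ∧ flipAt x i ≠ z := by decide
  set c : (Fin 2 → Bool) → ℕ := fun v => if v ∈ Y then l v else l x with hc
  have hcY : ∀ v ∈ Y, c v = l v := fun v hv => by simp [hc, hv]
  have hr : (monoOn (cubeGraph 2) c Set.univ).Reachable x y := by
    have hcxy : c x = c y := by rw [hcY x hx, hcY y hy, hxy]
    rcases hpath x y z with ⟨i, hi⟩ | ⟨i, j, hij, hiz⟩
    · exact SimpleGraph.Adj.reachable ⟨⟨i, hi⟩, hcxy, trivial, trivial⟩
    · have hcw : c (flipAt x i) = c x := by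
        rw [hcY x hx]
        by_cases hw : flipAt x i ∈ Y
        · rw [hcY _ hw]
          rcases hz _ hw with h | h | h
          · rw [h]
          · rw [h, hxy]
          · exact absurd h hiz
        · simp [hc, hw]
      have e1 : (monoOn (cubeGraph 2) c Set.univ).Adj x (flipAt x i) :=
        ⟨⟨i, rfl⟩, hcw.symm, trivial, trivial⟩
      have e2 : (monoOn (cubeGraph 2) c Set.univ).Adj (flipAt x i) y :=
        ⟨⟨j, hij⟩, hcw.trans hcxy, trivial, trivial⟩
      exact e1.reachable.trans e2.reachable
  refine ⟨c, hcY, fun u hu v hv huv => ?_⟩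
  by_cases huv' : u = v
  · rw [huv']
  have h3 : ∀ u ∈ Y, ∀ v ∈ Y, u ≠ v → l u = l v → u = x ∨ u = y := by
    intro u hu v hv hne' huv
    by_contra hcon
    push Not at hcon
    have huz : u = z := by rcases hz u hu with h | h | h <;> simp_all
    have hvx : l v = l x := by
      rcases hz v hv with h | h | h
      · rw [h]
      · rw [h, hxy]
      · exact absurd (huz.trans h.symm) hne'
    rcases hl x hx y hy u hu hxy (hvx.symm.trans huv.symm) with h | h | h
    · exact hne h
    · exact hcon.1 h.symm
    · exact hcon.2 h.symm
  rcases h3 u hu v hv huv' huv with h | h <;>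
    rcases h3 v hv u hu (Ne.symm huv') huv.symm with h' | h'
  · exact absurd (h.trans h'.symm) huv'
  · rw [h, h']; exact hr
  · rw [h, h']; exact hr.symm
  · exact absurd (h.trans h'.symm) huv'

/-- Five vertices contain at most two pairs, so besides `s`, `t` and a second pair one vertex is
left to be avoided. The set is padded to exactly five vertices to match `exists_connSets`. -/
theorem cubeLinked_four : CubeLinked 4 := by
  classical
  intro Y l hY hl
  by_cases hinj : ∀ x ∈ Y, ∀ y ∈ Y, l x = l y → x = y
  · exact linkable_of_injOn hinj
  push Not at hinj
  obtain ⟨s, hs, t, ht, hst, hne⟩ := hinj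
  obtain ⟨Y', hYY', hY'⟩ := Finset.exists_superset_card_eq hY
    (by rw [Fintype.card_fun, Fintype.card_fin, Fintype.card_bool]; norm_num)
  have hcard : ((Y'.erase s).erase t).card = 3 := by
    rw [Finset.card_erase_of_mem (Finset.mem_erase.2 ⟨hne.symm, hYY' ht⟩),
      Finset.card_erase_of_mem (hYY' hs)]
    omega
  obtain ⟨u, v, w, huv, huw, hvw, he⟩ := Finset.card_eq_three.1 hcard
  have hmem : ∀ y, y ∈ (Y'.erase s).erase t ↔ y = u ∨ y = v ∨ y = w := fun y => by simp [he]
  have hout : ∀ y, y = u ∨ y = v ∨ y = w → t ≠ y ∧ y ≠ s := fun y hy => by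
    have := (hmem y).2 hy
    rw [Finset.mem_erase, Finset.mem_erase] at this
    exact ⟨this.1.symm, this.2.1⟩
  have hYm : ∀ y ∈ Y, y = s ∨ y = t ∨ y = u ∨ y = v ∨ y = w := by
    intro y hy
    by_contra hcon
    push Not at hcon
    have := (hmem y).1 (Finset.mem_erase.2 ⟨hcon.2.1, Finset.mem_erase.2 ⟨hcon.1, hYY' hy⟩⟩)
    tauto
  have hlst : ∀ y ∈ Y, l s = l y → y = s ∨ y = t := by
    intro y hy h
    rcases hl s hs t ht y hy hst h with h | h | h
    · exact absurd h hne
    · exact Or.inl h.symm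
    · exact Or.inr h.symm
  have hnot : ∀ y ∈ Y, ∀ z ∈ Y, l y = l z → y ≠ s → y ≠ t → z ≠ s ∧ z ≠ t := by
    intro y hy z hz hyz hys hyt
    refine not_or.1 (fun h => ?_)
    have hsz : l s = l z := by rcases h with h | h <;> simp [h, hst]
    rcases hlst y hy (hsz.trans hyz.symm) with h | h
    · exact hys h
    · exact hyt h
  -- it suffices to choose the second pair
  have main : ∀ x a b : Fin 4 → Bool, (∀ y, y = x ∨ y = a ∨ y = b → t ≠ y ∧ y ≠ s) → x ≠ a →
      x ≠ b → a ≠ b → (∀ y ∈ Y, y = s ∨ y = t ∨ y = x ∨ y = a ∨ y = b) →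
      (∀ y ∈ Y, ∀ z ∈ Y, y ≠ z → l y = l z → y ≠ s → y ≠ t → (y = a ∨ y = b)) →
      Linkable (cubeGraph 4) Set.univ Y l := by
    intro x a b hx hxa hxb hab hYm hpair
    have h1 := hx x (by simp)
    have h2 := hx a (by simp)
    have h3 := hx b (by simp)
    obtain ⟨A, B, hAB, hxA, hxB, hsA, htA, haB, hbB, hA, hB⟩ := exists_connSets s t x a b hne.symm
      h1.2 h2.2 h3.2 h1.1 h2.1 h3.1 hxa hxb hab
    rw [Set.disjoint_left] at hAB
    have hAY : ∀ y ∈ A, y ∈ Y → l y = l s := by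
      intro y hyA hy
      rcases hYm y hy with h | h | h | h | h
      · rw [h]
      · rw [h, hst]
      · exact absurd (h ▸ hyA) hxA
      · exact absurd haB (hAB (h ▸ hyA))
      · exact absurd hbB (hAB (h ▸ hyA))
    have hBY : ∀ y ∈ B, y ∈ Y → y = a ∨ y = b := by
      intro y hyB hy
      rcases hYm y hy with h | h | h | h | h
      · exact absurd (h ▸ hyB) (hAB hsA)
      · exact absurd (h ▸ hyB) (hAB htA)
      · exact absurd (h ▸ hyB) hxB
      · exact Or.inl h
      · exact Or.inr h
    -- Nonterminals outside `A` may all take the colour of `a`, since only `B` must be monochromatic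
    -- for the second pair.
    set c : (Fin 4 → Bool) → ℕ := fun y => if y ∈ Y then l y else if y ∈ A then l s else l a with hc
    have hcY : ∀ y ∈ Y, c y = l y := fun y hy => by simp [hc, hy]
    refine ⟨c, hcY, fun y hy z hz hyz => ?_⟩
    by_cases hne' : y = z
    · rw [hne']
    by_cases hyA : y = s ∨ y = t
    · have hsy : l s = l y := by rcases hyA with h | h <;> simp [h, hst]
      have hzA := hlst z hz (hsy.trans hyz)
      refine hA.reachable (k := l s) (fun q hq => ?_) ?_ ?_
      · by_cases hqY : q ∈ Y
        · rw [hcY q hqY, hAY q hq hqY]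
        · simp [hc, hqY, hq]
      · rcases hyA with h | h <;> rw [h] <;> assumption
      · rcases hzA with h | h <;> rw [h] <;> assumption
    · push Not at hyA
      have hzs := hnot y hy z hz hyz hyA.1 hyA.2
      have hy' := hpair y hy z hz hne' hyz hyA.1 hyA.2
      have hz' := hpair z hz y hy (Ne.symm hne') hyz.symm hzs.1 hzs.2
      have hlab : l a = l y ∧ l b = l y := by
        rcases hy' with h | h <;> rcases hz' with h' | h' <;> simp_all
      refine hB.reachable (k := l a) (fun q hq => ?_) ?_ ?_
      · by_cases hqY : q ∈ Y
        · rw [hcY q hqY]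
          rcases hBY q hq hqY with h | h
          · rw [h]
          · rw [h, hlab.1, hlab.2]
        · have hqA : q ∉ A := fun h => hAB h hq
          simp [hc, hqY, hqA]
      · rcases hy' with h | h <;> rw [h] <;> assumption
      · rcases hz' with h | h <;> rw [h] <;> assumption
  have third : ∀ y z q, y ∈ Y → z ∈ Y → l y = l z → y ≠ z → q ∈ Y → l q = l y → q = y ∨ q = z := by
    intro y z q hy hz hyz hne' hq hqy
    rcases hl y hy z hz q hq hyz hqy.symm with h | h | h
    · exact absurd h hne'
    · exact Or.inl h.symm
    · exact Or.inr h.symm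
  by_cases huv' : u ∈ Y ∧ v ∈ Y ∧ l u = l v
  · refine main w u v (fun y hy => hout y (by tauto)) huw.symm hvw.symm huv
      (fun y hy => by have := hYm y hy; tauto) (fun y hy z hz hyz hlyz hys hyt => ?_)
    grind
  by_cases huw' : u ∈ Y ∧ w ∈ Y ∧ l u = l w
  · refine main v u w (fun y hy => hout y (by tauto)) huv.symm hvw huw
      (fun y hy => by have := hYm y hy; tauto) (fun y hy z hz hyz hlyz hys hyt => ?_)
    grind
  -- Either `v`, `w` is the second pair or there is none; the same choice serves both.
  · refine main u v w (fun y hy => hout y (by tauto)) huv huw hvw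
      (fun y hy => by have := hYm y hy; tauto) (fun y hy z hz hyz hlyz hys hyt => ?_)
    grind

theorem cubeLinked {d : ℕ} (hd : d ≠ 3) : CubeLinked d := by
  have h4 : ∀ n, 4 ≤ n → CubeLinked n := by
    intro n hn
    induction n, hn using Nat.le_induction with
    | base => exact cubeLinked_four
    | succ n hn ih => exact ih.succ hn
  by_cases h : 4 ≤ d
  · exact h4 d h
  · have : d = 0 ∨ d = 1 ∨ d = 2 := by omega
    rcases this with rfl | rfl | rfl
    · exact cubeLinked_zero
    · exact cubeLinked_one
    · exact cubeLinked_two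

/-! ### Faces of polytopes -/

section Faces

variable {n : ℕ} {P : Set (EuclideanSpace ℝ (Fin n))}

theorem IsPolytope.isCompact (hP : IsPolytope P) : IsCompact P := by
  obtain ⟨S, hS, rfl⟩ := hP
  exact hS.isCompact_convexHull ℝ

theorem IsPolytope.convex (hP : IsPolytope P) : Convex ℝ P := by
  obtain ⟨S, hS, rfl⟩ := hP
  exact convex_convexHull ℝ S

theorem IsPolytope.finite_extremePoints (hP : IsPolytope P) : (P.extremePoints ℝ).Finite := by
  obtain ⟨S, hS, rfl⟩ := hP
  exact hS.subset extremePoints_convexHull_subset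

theorem mem_extremePoints_of_isExposed {v : EuclideanSpace ℝ (Fin n)} (h : IsExposed ℝ P {v}) :
    v ∈ P.extremePoints ℝ :=
  isExtreme_singleton.1 h.isExtreme

/-- An extreme point lies outside the convex hull of the other generators, and a functional
separating it strictly from that hull is maximal only there. -/
theorem IsPolytope.isExposed_singleton (hP : IsPolytope P) {v : EuclideanSpace ℝ (Fin n)}
    (hv : v ∈ P.extremePoints ℝ) : IsExposed ℝ P {v} := by
  obtain ⟨S, hS, rfl⟩ := hP
  have hvS : v ∈ S := extremePoints_convexHull_subset hv
  set C := convexHull ℝ (S \ {v}) with hC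
  have hvC : v ∉ C := by
    have hconv := ((convex_convexHull ℝ S).mem_extremePoints_iff_convex_sdiff.1 hv).2
    have hsub : C ⊆ convexHull ℝ S \ {v} :=
      convexHull_min (fun y hy => ⟨subset_convexHull ℝ S hy.1, hy.2⟩) hconv
    exact fun h => (hsub h).2 rfl
  obtain ⟨f, u, hfu, huv⟩ := geometric_hahn_banach_closed_point (convex_convexHull ℝ (S \ {v}))
    ((hS.subset Set.sdiff_subset).isClosed_convexHull ℝ) hvC
  intro _
  have hle : ∀ y ∈ convexHull ℝ S, f y ≤ f v := by
    have hsub : convexHull ℝ S ⊆ {y | f y ≤ f v} := by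
      refine convexHull_min (fun y hy => ?_) (convex_halfSpace_le f.toLinearMap.isLinear _)
      by_cases h : y = v
      · exact h ▸ le_refl (f y)
      · exact ((hfu y (subset_convexHull ℝ _ ⟨hy, h⟩)).trans huv).le
    exact hsub
  refine ⟨f, Set.Subset.antisymm ?_ ?_⟩
  · rintro y rfl
    exact ⟨hv.1, hle⟩
  · rintro y ⟨hy, hmax⟩
    rw [← Set.insert_sdiff_self_of_mem hvS] at hy
    rcases (S \ {v}).eq_empty_or_nonempty with he | hne
    · rw [he] at hy
      simpa using hy
    · rw [convexHull_insert hne, mem_convexJoin] at hy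
      obtain ⟨v', rfl, z, hz, a, b, ha, hb, hab, rfl⟩ := hy
      have h1 := hmax v' hv.1
      have h2 := (hfu z hz).trans huv
      rw [map_add, map_smul, map_smul, smul_eq_mul, smul_eq_mul] at h1
      have hb0 : b = 0 := by
        by_contra hb'
        have hbpos : 0 < b := lt_of_le_of_ne hb (Ne.symm hb')
        have ha' : a = 1 - b := by linarith
        rw [ha'] at h1
        nlinarith
      have ha1 : a = 1 := by linarith
      simp [hb0, ha1]

/-- This is Krein–Milman; the closure is superfluous because there are finitely many extreme points.
-/
theorem IsPolytope.face_eq_convexHull (hP : IsPolytope P) {F : Set (EuclideanSpace ℝ (Fin n))}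
    (hF : IsExposed ℝ P F) : F = convexHull ℝ (F ∩ P.extremePoints ℝ) := by
  have h := closure_convexHull_extremePoints (hF.isCompact hP.isCompact) (hF.convex hP.convex)
  rw [hF.isExtreme.extremePoints_eq] at h
  rw [((hP.finite_extremePoints.subset Set.inter_subset_right).isClosed_convexHull ℝ).closure_eq]
    at h
  exact h.symm

theorem exists_extremePoint_mem_face (hP : IsCompact P) {F : Set (EuclideanSpace ℝ (Fin n))}
    (hF : IsExposed ℝ P F) (hne : F.Nonempty) : ∃ v ∈ F, v ∈ P.extremePoints ℝ := by
  obtain ⟨v, hv⟩ := (hF.isCompact hP).extremePoints_nonempty hne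
  rw [hF.isExtreme.extremePoints_eq] at hv
  exact ⟨v, hv.1, hv.2⟩

instance instOrderBotFaceLattice : OrderBot (FaceLattice P) where
  bot := ⟨∅, isExposed_empty⟩
  bot_le F := Set.empty_subset F.1

theorem FaceLattice.isAtom_singleton {v : EuclideanSpace ℝ (Fin n)} (h : IsExposed ℝ P {v}) :
    IsAtom (⟨{v}, h⟩ : FaceLattice P) := by
  refine ⟨fun e => ?_, fun F hF => ?_⟩
  · have : ({v} : Set (EuclideanSpace ℝ (Fin n))) = ∅ := congrArg Subtype.val e
    exact Set.singleton_ne_empty v this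
  · have hlt : F.1 ⊂ {v} := hF
    exact Subtype.ext (Set.ssubset_singleton_iff.1 hlt)

/-- If extreme points are exposed, the atoms of the face lattice are the vertices. -/
theorem FaceLattice.exists_eq_singleton_of_isAtom (hP : IsCompact P)
    (hext : ∀ v ∈ P.extremePoints ℝ, IsExposed ℝ P {v}) {F : FaceLattice P} (hF : IsAtom F) :
    ∃ v, F.1 = {v} := by
  have hne : F.1.Nonempty := by
    rw [Set.nonempty_iff_ne_empty]
    exact fun e => hF.1 (Subtype.ext e)
  obtain ⟨v, hvF, hv⟩ := exists_extremePoint_mem_face hP F.2 hne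
  refine ⟨v, ?_⟩
  by_contra hcon
  have hlt : (⟨{v}, hext v hv⟩ : FaceLattice P) < F :=
    lt_of_le_of_ne (Set.singleton_subset_iff.2 hvF) (fun e => hcon (congrArg Subtype.val e).symm)
  exact (FaceLattice.isAtom_singleton (hext v hv)).1 (hF.2 _ hlt)

end Faces

/-! ### The standard cube -/

/-- The vertex of `[0,1]^d` with given coordinates. -/
noncomputable def cubePoint {d : ℕ} (x : Fin d → Bool) : EuclideanSpace ℝ (Fin d) :=
  WithLp.toLp 2 (fun i => if x i then 1 else 0)

theorem cubePoint_apply {d : ℕ} (x : Fin d → Bool) (i : Fin d) :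
    cubePoint x i = if x i then 1 else 0 := rfl

theorem cubePoint_mem {d : ℕ} (x : Fin d → Bool) : cubePoint x ∈ stdCube d := by
  intro i
  rw [cubePoint_apply]
  split_ifs <;> norm_num

theorem cubePoint_apply_eq_iff {d : ℕ} {x y : Fin d → Bool} {i : Fin d} :
    cubePoint x i = cubePoint y i ↔ x i = y i := by
  rw [cubePoint_apply, cubePoint_apply]
  cases x i <;> cases y i <;> simp

theorem cubePoint_injective {d : ℕ} : Function.Injective (cubePoint (d := d)) := by
  intro x y h
  ext i
  rw [cubePoint_apply_eq_iff.1 (congrArg (fun z : EuclideanSpace ℝ (Fin d) => z i) h)]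

theorem isCompact_stdCube (d : ℕ) : IsCompact (stdCube d) := by
  have h : IsCompact (Set.univ.pi fun _ : Fin d => Set.Icc (0 : ℝ) 1) :=
    isCompact_univ_pi fun _ => isCompact_Icc
  have h2 := h.image (PiLp.continuous_toLp 2 (fun _ : Fin d => ℝ))
  convert h2 using 1
  ext x
  constructor
  · intro hx
    exact ⟨fun i => x i, fun i _ => hx i, rfl⟩
  · rintro ⟨y, hy, rfl⟩ i
    exact hy i trivial

/-- Fixing some coordinates to those of a vertex gives a face of the standard cube. -/
theorem isExposed_stdCube {d : ℕ} (J : Finset (Fin d)) (x : Fin d → Bool) :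
    IsExposed ℝ (stdCube d) {y ∈ stdCube d | ∀ j ∈ J, y j = cubePoint x j} := by
  intro _
  -- Each summand is maximal on the cube exactly when coordinate `j` equals that of the vertex `x`.
  let f : StrongDual ℝ (EuclideanSpace ℝ (Fin d)) :=
    ∑ j ∈ J, (if x j then (1 : ℝ) else -1) •
      (EuclideanSpace.proj j : EuclideanSpace ℝ (Fin d) →L[ℝ] ℝ)
  have hf : ∀ y, f y = ∑ j ∈ J, (if x j then (1 : ℝ) else -1) * y j := by
    intro y
    simp only [f, sum_apply, smul_apply, smul_eq_mul]
    rfl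
  have hle : ∀ y ∈ stdCube d, ∀ j ∈ J, (if x j then (1 : ℝ) else -1) * y j ≤
      (if x j then (1 : ℝ) else -1) * cubePoint x j := by
    intro y hy j _
    have := hy j
    rw [cubePoint_apply]
    split_ifs <;> linarith
  refine ⟨f, Set.Subset.antisymm ?_ ?_⟩
  · rintro y ⟨hy, hyJ⟩
    refine ⟨hy, fun z hz => ?_⟩
    rw [hf, hf]
    refine Finset.sum_le_sum (fun j hj => ?_)
    rw [hyJ j hj]
    exact hle z hz j hj
  · rintro y ⟨hy, hmax⟩
    refine ⟨hy, fun j hj => ?_⟩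
    have h1 := hmax _ (cubePoint_mem x)
    rw [hf, hf] at h1
    have h2 := (Finset.sum_eq_sum_iff_of_le (hle y hy)).1
      (le_antisymm (Finset.sum_le_sum (hle y hy)) h1) j hj
    split_ifs at h2 <;> linarith

theorem isExposed_cubePoint {d : ℕ} (x : Fin d → Bool) :
    IsExposed ℝ (stdCube d) {cubePoint x} := by
  convert isExposed_stdCube Finset.univ x using 1
  ext y
  constructor
  · rintro rfl
    exact ⟨cubePoint_mem x, fun _ _ => rfl⟩
  · rintro ⟨-, h⟩
    ext j
    exact h j (Finset.mem_univ j)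

theorem exists_cubePoint_of_mem_extremePoints {d : ℕ} {v : EuclideanSpace ℝ (Fin d)}
    (hv : v ∈ (stdCube d).extremePoints ℝ) : ∃ x, v = cubePoint x := by
  obtain ⟨hvc, hv⟩ := mem_extremePoints.1 hv
  have h01 : ∀ i, v i = 0 ∨ v i = 1 := by
    intro i
    by_contra hcon
    push Not at hcon
    have h0 : 0 < v i := lt_of_le_of_ne (hvc i).1 (Ne.symm hcon.1)
    have h1 : v i < 1 := lt_of_le_of_ne (hvc i).2 hcon.2
    -- A fractional coordinate places `v` strictly between the points with that coordinate set to 0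
    -- and to 1.
    have key : ∀ r : ℝ, 0 ≤ r → r ≤ 1 →
        (WithLp.toLp 2 (Function.update (fun j => v j) i r) : EuclideanSpace ℝ (Fin d)) ∈
          stdCube d := by
      intro r hr0 hr1 j
      by_cases hj : j = i
      · subst hj; simpa using ⟨hr0, hr1⟩
      · simpa [hj] using hvc j
    have := hv _ (key 0 le_rfl zero_le_one) _ (key 1 zero_le_one le_rfl)
      ⟨1 - v i, v i, by linarith, h0, by ring, by
        ext j
        by_cases hj : j = i
        · subst hj; simp
        · simp [hj]; ring⟩
    have h2 := congrArg (fun z : EuclideanSpace ℝ (Fin d) => z i) this.1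
    simp only [Function.update_self] at h2
    exact hcon.1 h2.symm
  refine ⟨fun i => decide (v i = 1), ?_⟩
  ext i
  rw [cubePoint_apply]
  rcases h01 i with h | h <;> simp [h]

/-- The vertices of a `d`-cube are in bijection with those of the standard cube, so that the ends
of an edge of the standard cube correspond to adjacent vertices. -/
theorem IsCube.exists_equiv {n d : ℕ} {P : Set (EuclideanSpace ℝ (Fin n))} (hP : IsCube d P) :
    ∃ φ : (Fin d → Bool) ≃ {v : EuclideanSpace ℝ (Fin n) // IsExposed ℝ P {v}},
      ∀ x i, (polytopeGraph P).Adj (φ x) (φ (flipAt x i)) := by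
  obtain ⟨hP, ⟨e⟩⟩ := hP
  have hatomP : ∀ F : FaceLattice P, IsAtom F → ∃ v, F.1 = {v} := fun F hF =>
    FaceLattice.exists_eq_singleton_of_isAtom hP.isCompact
      (fun v hv => hP.isExposed_singleton hv) hF
  have hatomC : ∀ F : FaceLattice (stdCube d), IsAtom F → ∃ x, F.1 = {cubePoint x} := by
    intro F hF
    obtain ⟨v, hv⟩ := FaceLattice.exists_eq_singleton_of_isAtom (isCompact_stdCube d)
      (fun v hv => by
        obtain ⟨x, rfl⟩ := exists_cubePoint_of_mem_extremePoints hv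
        exact isExposed_cubePoint x) hF
    obtain ⟨x, rfl⟩ := exists_cubePoint_of_mem_extremePoints
      (mem_extremePoints_of_isExposed (hv ▸ F.2))
    exact ⟨x, hv⟩
  let c : (Fin d → Bool) → FaceLattice (stdCube d) :=
    fun x => ⟨{cubePoint x}, isExposed_cubePoint x⟩
  have hc : ∀ x, ∃ v, (e.symm (c x)).1 = {v} := fun x =>
    hatomP _ ((e.symm.isAtom_iff _).2 (FaceLattice.isAtom_singleton _))
  choose f hf using hc
  let φ : (Fin d → Bool) → {v : EuclideanSpace ℝ (Fin n) // IsExposed ℝ P {v}} :=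
    fun x => ⟨f x, hf x ▸ (e.symm (c x)).2⟩
  have hφ : ∀ x, e ⟨{(φ x).1}, (φ x).2⟩ = c x := by
    intro x
    rw [← e.apply_symm_apply (c x)]
    exact congrArg e (Subtype.ext (hf x).symm)
  have hinj : Function.Injective φ := by
    intro x y hxy
    have h : c x = c y := by rw [← hφ x, ← hφ y, hxy]
    exact cubePoint_injective (Set.singleton_injective (congrArg Subtype.val h))
  have hsurj : Function.Surjective φ := by
    intro v
    obtain ⟨x, hx⟩ := hatomC (e ⟨{v.1}, v.2⟩)
      ((e.isAtom_iff _).2 (FaceLattice.isAtom_singleton v.2))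
    refine ⟨x, ?_⟩
    have h1 : e ⟨{v.1}, v.2⟩ = e ⟨{(φ x).1}, (φ x).2⟩ := by
      rw [hφ x]; exact Subtype.ext hx
    have h2 := congrArg Subtype.val (e.injective h1)
    exact Subtype.ext (Set.singleton_injective h2).symm
  refine ⟨Equiv.ofBijective φ ⟨hinj, hsurj⟩, fun x i => ⟨fun h => flipAt_ne x i (hinj h).symm, ?_⟩⟩
  -- `E` is the edge from `x` in direction `i`. Order preservation gives the corresponding face of
  -- `P` exactly two vertices, so it is their segment.
  let E : FaceLattice (stdCube d) := ⟨_, isExposed_stdCube (Finset.univ.erase i) x⟩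
  have hmem : ∀ y, (φ y).1 ∈ (e.symm E).1 ↔ y = x ∨ y = flipAt x i := by
    intro y
    have h1 : (φ y).1 ∈ (e.symm E).1 ↔ (⟨{(φ y).1}, (φ y).2⟩ : FaceLattice P) ≤ e.symm E :=
      Set.singleton_subset_iff.symm
    have h2 : c y ≤ E ↔ cubePoint y ∈ E.1 := Set.singleton_subset_iff
    rw [h1, e.le_symm_apply, hφ y, h2]
    constructor
    · rintro ⟨-, h⟩
      have hj : ∀ j, j ≠ i → y j = x j := fun j hj =>
        cubePoint_apply_eq_iff.1 (h j (Finset.mem_erase.2 ⟨hj, Finset.mem_univ j⟩))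
      by_cases hi : y i = x i
      · left
        funext j
        by_cases hji : j = i
        · rw [hji, hi]
        · exact hj j hji
      · right
        funext j
        by_cases hji : j = i
        · subst hji
          rw [flipAt_same]
          exact Bool.eq_not_of_ne hi
        · rw [flipAt_of_ne _ hji]
          exact hj j hji
    · intro h
      refine ⟨cubePoint_mem y, fun j hj => cubePoint_apply_eq_iff.2 ?_⟩
      rcases h with rfl | rfl
      · rfl
      · exact flipAt_of_ne _ (Finset.ne_of_mem_erase hj)
  have hF : (e.symm E).1 = segment ℝ (φ x).1 (φ (flipAt x i)).1 := by
    rw [hP.face_eq_convexHull (e.symm E).2, ← convexHull_pair]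
    congr 1
    ext v
    constructor
    · rintro ⟨hv, hve⟩
      obtain ⟨y, hy⟩ := hsurj ⟨v, hP.isExposed_singleton hve⟩
      have hy' : (φ y).1 = v := congrArg Subtype.val hy
      rw [← hy'] at hv ⊢
      rcases (hmem y).1 hv with h | h
      · left; rw [h]
      · right; rw [h]; rfl
    · rintro (rfl | rfl)
      · exact ⟨(hmem x).2 (Or.inl rfl), mem_extremePoints_of_isExposed (φ x).2⟩
      · exact ⟨(hmem _).2 (Or.inr rfl), mem_extremePoints_of_isExposed (φ _).2⟩
  change IsExposed ℝ P (segment ℝ (φ x).1 (φ (flipAt x i)).1)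
  rw [← hF]
  exact (e.symm E).2

/-! ### Strong linkedness -/

theorem exists_path_of_reachable {V W : Type*} {G : SimpleGraph V} {H : SimpleGraph W}
    {c : V → ℕ} {A : Set V} (φ : V ≃ W) (hφ : ∀ u v, G.Adj u v → H.Adj (φ u) (φ v)) {u v : V}
    (h : (monoOn G c A).Reachable u v) :
    ∃ p : H.Path (φ u) (φ v), ∀ w ∈ p.1.support, c (φ.symm w) = c u := by
  classical
  obtain ⟨q⟩ := h
  have key : ∃ p : H.Walk (φ u) (φ v), ∀ w ∈ p.support, c (φ.symm w) = c u := by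
    induction q with
    | nil => exact ⟨SimpleGraph.Walk.nil, by simp⟩
    | cons h _ ih =>
      obtain ⟨p, hp⟩ := ih
      refine ⟨SimpleGraph.Walk.cons (hφ _ _ h.1) p, fun w hw => ?_⟩
      rw [SimpleGraph.Walk.support_cons, List.mem_cons] at hw
      rcases hw with rfl | hw
      · simp
      · rw [hp w hw, h.2.1]
  obtain ⟨p, hp⟩ := key
  exact ⟨p.toPath, fun w hw => hp w (p.support_toPath_subset_support hw)⟩

/-- A linkage of the cube gives strong linkedness of every graph containing it as a spanning
subgraph. -/
theorem CubeLinked.isStronglyLinked {d : ℕ} (hd : CubeLinked d) {W : Type*} {H : SimpleGraph W}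
    (φ : (Fin d → Bool) ≃ W) (hφ : ∀ x i, H.Adj (φ x) (φ (flipAt x i))) :
    IsStronglyLinked d H := by
  classical
  refine ⟨?_, fun X hX s t hs ht hst => ?_⟩
  · rw [← ENat.card_congr φ, ENat.card_eq_coe_fintype_card, Fintype.card_fun, Fintype.card_bool,
      Fintype.card_fin]
    exact_mod_cast Nat.lt_two_pow_self
  have hss : ∀ i j, s i = s j → i = j := fun i j h => Sum.inl_injective (hst (by simpa using h))
  have htt : ∀ i j, t i = t j → i = j := fun i j h => Sum.inr_injective (hst (by simpa using h))
  have hsne : ∀ i j, s i ≠ t j := fun i j h => Sum.inl_ne_inr (hst (a₁ := Sum.inl i)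
    (a₂ := Sum.inr j) (by simpa using h))
  -- the terminals outside the pairs
  have hrest : (X \ Finset.univ.image (Sum.elim s t)).card ≤ 1 := by
    rw [Finset.card_sdiff_of_subset, Finset.card_image_of_injective _ hst, hX]
    · simp only [Finset.card_univ, Fintype.card_sum, Fintype.card_fin]
      omega
    · intro x hx
      obtain ⟨i | i, -, rfl⟩ := Finset.mem_image.1 hx
      · exact hs i
      · exact ht i
  have hout : ∀ x ∈ X, (∀ j, x ≠ s j ∧ x ≠ t j) → x ∈ X \ Finset.univ.image (Sum.elim s t) := by
    intro x hx hj
    refine Finset.mem_sdiff.2 ⟨hx, fun h => ?_⟩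
    obtain ⟨i | i, -, rfl⟩ := Finset.mem_image.1 h
    · exact (hj i).1 rfl
    · exact (hj i).2 rfl
  -- A paired terminal is labelled by its index; `(d + 1) / 2` is the first number that is not an
  -- index.
  set m : W → ℕ := fun w =>
    if h : ∃ i, w = s i ∨ w = t i then (h.choose : ℕ) else (d + 1) / 2 with hm
  have hm1 : ∀ w i, w = s i ∨ w = t i → m w = i := by
    intro w i hw
    have hex : ∃ i, w = s i ∨ w = t i := ⟨i, hw⟩
    have hspec := hex.choose_spec
    simp only [hm, dif_pos hex]
    congr 1
    rcases hw with hw | hw <;> rcases hspec with h | h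
    · exact hss _ _ (h.symm.trans hw)
    · exact absurd (hw.symm.trans h) (hsne _ _)
    · exact absurd (h.symm.trans hw) (hsne _ _)
    · exact htt _ _ (h.symm.trans hw)
  have hm2 : ∀ w, (∀ j, w ≠ s j ∧ w ≠ t j) → m w = (d + 1) / 2 := by
    intro w hw
    have : ¬ ∃ i, w = s i ∨ w = t i := by
      rintro ⟨i, h | h⟩
      · exact (hw i).1 h
      · exact (hw i).2 h
    simp only [hm, dif_neg this]
  have hm3 : ∀ w, (∃ i : Fin ((d + 1) / 2), m w = i ∧ (w = s i ∨ w = t i)) ∨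
      (m w = (d + 1) / 2 ∧ ∀ j, w ≠ s j ∧ w ≠ t j) := by
    intro w
    by_cases h : ∃ i, w = s i ∨ w = t i
    · obtain ⟨i, hi⟩ := h
      exact Or.inl ⟨i, hm1 w i hi, hi⟩
    · push Not at h
      exact Or.inr ⟨hm2 w h, h⟩
  have hpl : PairLabelled (X.image φ.symm) (fun x => m (φ x)) := by
    simp only [PairLabelled, Finset.mem_image, forall_exists_index, and_imp,
      forall_apply_eq_imp_iff₂, Equiv.apply_symm_apply, EmbeddingLike.apply_eq_iff_eq]
    intro x hx y hy z hz hxy hxz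
    rcases hm3 x with ⟨i, hxi, hx'⟩ | ⟨hxk, hx'⟩
    · have aux : ∀ w, m x = m w → w = s i ∨ w = t i := by
        intro w hw
        rcases hm3 w with ⟨j, hwj, hw'⟩ | ⟨hwk, -⟩
        · have : j = i := Fin.ext (by rw [← hwj, ← hw, hxi])
          exact this ▸ hw'
        · exact absurd (hxi.symm.trans (hw.trans hwk)) i.2.ne
      rcases hx' with h1 | h1 <;> rcases aux y hxy with h2 | h2 <;>
        rcases aux z hxz with h3 | h3 <;> simp [h1, h2, h3]
    · have aux : ∀ w, m x = m w → ∀ j, w ≠ s j ∧ w ≠ t j := by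
        intro w hw
        rcases hm3 w with ⟨j, hwj, -⟩ | ⟨-, hw'⟩
        · exact absurd (hwj.symm.trans (hw.symm.trans hxk)) j.2.ne
        · exact hw'
      exact Or.inl (Finset.card_le_one.1 hrest x (hout x hx hx') y (hout y hy (aux y hxy)))
  obtain ⟨c, hc1, hc2⟩ := hd (X.image φ.symm) (fun x => m (φ x))
    (Finset.card_image_le.trans hX.le) hpl
  have hcX : ∀ x ∈ X, c (φ.symm x) = m x := fun x hx => by
    rw [hc1 _ (Finset.mem_image_of_mem _ hx)]
    exact congrArg m (φ.apply_symm_apply x)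
  have hadj : ∀ u v, (cubeGraph d).Adj u v → H.Adj (φ u) (φ v) := by
    rintro u v ⟨j, rfl⟩
    exact hφ u j
  have hpath : ∀ i, ∃ p : H.Path (s i) (t i), ∀ w ∈ p.1.support, c (φ.symm w) = i := by
    intro i
    obtain ⟨p, hp⟩ := exists_path_of_reachable φ hadj
      (hc2 (φ.symm (s i)) (Finset.mem_image_of_mem _ (hs i)) (φ.symm (t i))
        (Finset.mem_image_of_mem _ (ht i))
        (by simp [hm1 (s i) i (Or.inl rfl), hm1 (t i) i (Or.inr rfl)]))
    rw [hcX _ (hs i), hm1 (s i) i (Or.inl rfl)] at hp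
    revert p
    rw [φ.apply_symm_apply, φ.apply_symm_apply]
    exact fun p hp => ⟨p, hp⟩
  choose L hL using hpath
  refine ⟨L, fun i j hij v hv hv' => hij (Fin.ext ((hL i v hv).symm.trans (hL j v hv'))),
    fun x hx hxj i hxi => ?_⟩
  have h1 := hL i x hxi
  rw [hcX x hx, hm2 x hxj] at h1
  exact i.2.ne h1.symm

theorem mainTheorem5 (d : ℕ) (hd : d ≠ 3) (n : ℕ) (P : Set (EuclideanSpace ℝ (Fin n)))
    (hP : IsCube d P) : IsStronglyLinked d (polytopeGraph P) := by
  obtain ⟨φ, hφ⟩ := hP.exists_equiv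
  exact (cubeLinked hd).isStronglyLinked φ hφ
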